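/- **Setting.** Let $x\in\{1,2\}$ denote inputs and $a\in\{+1,-1\}$ outputs. Vectors such as $\vec E=(E_1,E_2)$, $\vec\omega=(\omega_1,\omega_2)$ lie in $\mathbb R^2$, and inequalities between vectors are componentwise. A behaviour $(\vec E,\vec\omega)\in\mathbb R^4$ is *realisable* if on some Hilbert space there are density operators $\rho_1,\rho_2$, an observable $-1\le M\le 1$ and an observable $O$ with an orthonormal eigenbasis, with non-degenerate lowest eigenvalue $0$ and all other eigenvalues at least $1$, such that $\mathrm{Tr}[\rho_xM]=E_x$ and $\mathrm{Tr}[\rho_xO]\le\omega_x$ for $x=1,2$. Let $\mathcal Q$ be the convex hull of the set of realisable behaviours. **Device.** Let $n\ge 1$, let $p(1),p(2)>0$ with $p(1)+p(2)=1$, let $\vec 0\le\vec\omega_{\rm avg}\le\vec\omega_{\rm pk}\le\vec 1$ and $\epsilon_\omega\ge 0$. Let $\mu$ be a distribution of $(A^n,X^n,\Lambda)$ with $A_i\in\{\pm1\}$, $X_i\in\{1,2\}$ and $\Lambda$ a discrete random variable. Write $W_i=(A^{i-1},X^{i-1})$ and assume that for each $i$ there are functions $\vec E_i,\vec\omega_i$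 of $(W_i,\Lambda)$ with values satisfying $(\vec E_i(W_i,\Lambda),\vec\omega_i(W_i,\Lambda))\in\mathcal Q$ and $\vec\omega_i(W_i,\Lambda)\le\vec\omega_{\rm pk}$, such that $\mu(X_i=x\mid W_i,\Lambda)=p(x)$, $\mu(A_i=a\mid X_i=x,W_i,\Lambda)=\frac12\big(1+aE_{x,i}(W_i,\Lambda)\big)$, and $$\Pr\Big(\tfrac1n\sum_{i=1}^n\vec\omega_i(W_i,\Lambda)\le\vec\omega_{\rm avg}\Big)\ge 1-\epsilon_\omega .$$ **Test.** Let $(\vec\alpha,\vec\beta,\vec\gamma)\in(\mathbb R^2)^3$ be a trade-off function, that is, $\vec\gamma\le 0$ and $\alpha_1+\alpha_2+\vec\beta\cdot\vec E+\vec\gamma\cdot\vec\omega\le H(\vec E)$ for all $(\vec E,\vec\omega)\in\mathcal Q$ with $\vec\omega\le\vec\omega_{\rm pk}$, where $H(\vec E)=-\sum_{a,x}p(x)\frac{1+aE_x}{2}\log_2\frac{1+aE_x}{2}$. Put $\xi(a,x)=\frac{\alpha_x+a\beta_x}{p(x)}$, $\xi^+=\max_{a,x}\xi(a,x)$, $\xi^-=\min_{a,x}\xi(a,x)$,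 $\bar\gamma=\gamma_1+\gamma_2$, and assume $\xi^+\ge 0$. Let $0<\epsilon_t\le1$, $0<\epsilon_m\le 1$ and, with $|A|=2$, $$V=\max\{(\xi^++\bar\gamma)^2,(\xi^-+\bar\gamma)^2\}+2\max\{-\log_2|A|\,(\bar\gamma+\xi^-),0\}+\tfrac{4|A|}{e^2}(\log_2 e)^2,$$ $$t=\sqrt{2V}\sqrt{\tfrac{\log_2(1/\epsilon_t)}{n}}+\tfrac{\xi^+}{3}\,\tfrac{\log_2(1/\epsilon_t)}{n}.$$ Let $r\in\mathbb R$ with $r-t\le1$, let $\mathrm{Pass}$ be the event $\frac1n\sum_i\xi(A_i,X_i)+\vec\gamma\cdot\vec\omega_{\rm avg}\ge r$, suppose $\kappa=\Pr(\mathrm{Pass})>0$, and let $\mu_{\rm Pass}$ be $\mu$ conditioned on $\mathrm{Pass}$. **Entropies.** For a discrete distribution $\mu'$ of $(A,Z)$, $H^{\epsilon}_{\min,\mu'}(A|Z)$ is the largest $k$ for which there is a distribution $\nu$ of $(A,Z)$ with the same marginal on $Z$ as $\mu'$, with $\frac12\sum_{a,z}|\nu(a,z)-\mu'(a,z)|\le\epsilon$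 and with $-\log_2\mathbb E\big[\max_a\nu(a|Z)\big]\ge k$; and $H^{u,\epsilon}_{\min,\mu'}(A|Z)$ is defined in the same way with the last condition replaced by $-\log_2\nu(a|z)\ge k$ for all $a,z$. **Proposition.** Then $$H^{(\epsilon_\omega+\epsilon_t)/\kappa}_{\min,\mu_{\rm Pass}}(A^n|X^n\Lambda)\ \ge\ n(r-t)-\log_2\tfrac1\kappa ,$$ $$H^{u,(\epsilon_\omega+\epsilon_t+\epsilon_m)/\kappa}_{\min,\mu_{\rm Pass}}(A^n|X^n\Lambda)\ \ge\ n(r-t)-\log_2\tfrac1{\epsilon_m}\ =\ \sigma_h ,$$ where $\sigma_h=n\Big(r-\sqrt{2V}\sqrt{\tfrac{\log_2(1/\epsilon_t)}{n}}-\tfrac{\xi^+}{3}\tfrac{\log_2(1/\epsilon_t)}{n}-\tfrac{\log_2(1/\epsilon_m)}{n}\Big)$; in both cases the right-hand side is itself attained by some $\nu$ as in the definition. -/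

import Mathlib

open scoped ENNReal

noncomputable section

namespace SemiDI

/-! ### Outputs, inputs and the quantum set -/

/-- The outputs `a ∈ {+1, -1}`. -/
abbrev Output : Type := ℤˣ

/-- The two inputs (the indices `0, 1` stand for `x = 1, 2`). -/
abbrev Input : Type := Fin 2

/-- The real number `+1` or `-1` attached to an output. -/
def outVal (a : Output) : ℝ := ((a : ℤ) : ℝ)

section Quantum

variable {H : Type} [NormedAddCommGroup H] [InnerProductSpace ℂ H]

/-- `Tr T = c`, computed in the Hilbert basis `b`. -/
def HasTrace {ι : Type} (b : HilbertBasis ι ℂ H) (T : H →L[ℂ] H) (c : ℂ) : Prop :=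
  HasSum (fun i => inner ℂ (b i) (T (b i))) c

/-- An energy observable `O = ∑ i, eigenvalue i • |b i⟩⟨b i|`, given by its spectral
decomposition (so that unbounded observables such as a number operator are allowed):
the eigenvalue `0` occurs exactly once, at the vacuum, and all others are at least `1`. -/
structure EnergyObservable (H : Type) [NormedAddCommGroup H] [InnerProductSpace ℂ H] where
  ι : Type
  basis : HilbertBasis ι ℂ H
  eigenvalue : ι → ℝ
  vacuum : ι
  eigenvalue_vacuum : eigenvalue vacuum = 0
  one_le_eigenvalue : ∀ i, i ≠ vacuum → 1 ≤ eigenvalue i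

/-- `Tr [ρ O] ≤ w` for a positive operator `ρ`; in the eigenbasis of `O` the trace is the series
of non-negative terms `eigenvalue i * ⟨b i, ρ (b i)⟩`, and it has to be finite. -/
def EnergyObservable.MeanLE (O : EnergyObservable H) (ρ : H →L[ℂ] H) (w : ℝ) : Prop :=
  ∃ e : ℝ, HasSum
    (fun i => O.eigenvalue i * (inner ℂ (O.basis i) (ρ (O.basis i))).re) e ∧ e ≤ w

end Quantum

/-- A behaviour `(E, ω)`: two correlations and two energy bounds. -/
abbrev Behaviour : Type := (Input → ℝ) × (Input → ℝ)

/-- Behaviours realised by two states `ρ x`, an observable `-1 ≤ M ≤ 1` and an energy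
observable `O` on some Hilbert space, through `Tr [ρ x M] = E x` and `Tr [ρ x O] ≤ ω x`. -/
def IsRealisable (q : Behaviour) : Prop :=
  ∃ (H : Type) (_ : NormedAddCommGroup H) (_ : InnerProductSpace ℂ H) (_ : CompleteSpace H)
    (O : EnergyObservable H) (ρ : Input → H →L[ℂ] H) (M : H →L[ℂ] H),
    (∀ x, (ρ x).IsPositive ∧ HasTrace O.basis (ρ x) 1) ∧
    ((1 : H →L[ℂ] H) - M).IsPositive ∧ ((1 : H →L[ℂ] H) + M).IsPositive ∧
    (∀ x, HasTrace O.basis (ρ x ∘L M) (q.1 x : ℂ)) ∧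
    (∀ x, O.MeanLE (ρ x) (q.2 x))

/-- The quantum set `𝒬`: convex combinations of realisable behaviours. -/
def quantumSet : Set Behaviour := convexHull ℝ {q | IsRealisable q}

/-! ### Discrete probability -/

/-- Probability of an event under a discrete distribution. -/
def prob {Ω : Type*} (μ : PMF Ω) (S : Set Ω) : ℝ := (μ.toOuterMeasure S).toReal

theorem exists_mem_support_of_prob_pos {Ω : Type*} {μ : PMF Ω} {S : Set Ω}
    (h : 0 < prob μ S) : ∃ w ∈ S, w ∈ μ.support := by
  by_contra hc
  have hd : Disjoint μ.support S := by
    rw [Set.disjoint_left]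
    intro w hw hS
    exact hc ⟨w, hS, hw⟩
  have h0 : μ.toOuterMeasure S = 0 := (PMF.toOuterMeasure_apply_eq_zero_iff μ S).2 hd
  simp [prob, h0] at h

/-- The distribution `μ` conditioned on an event of positive probability. -/
def condOn {Ω : Type*} (μ : PMF Ω) (S : Set Ω) (h : 0 < prob μ S) : PMF Ω :=
  μ.filter S (exists_mem_support_of_prob_pos h)

/-- Total variation distance `½ ∑ |μ - ν|`. -/
def tvDist {Ω : Type*} (μ ν : PMF Ω) : ℝ := (1 / 2) * ∑' w, |(μ w).toReal - (ν w).toReal|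

/-- The marginal distribution of `Z` under a distribution of `AZ`. -/
def marginalZ {A Z : Type*} (ν : PMF (A × Z)) : PMF Z := ν.map Prod.snd

/-- The conditional probability `ν(a|z)` (it is `0` where `ν(z) = 0`). -/
def condProb {A Z : Type*} (ν : PMF (A × Z)) (a : A) (z : Z) : ℝ≥0∞ := ν (a, z) / marginalZ ν z

/-- The numbers `k` for which some `ν` with the same marginal of `Z` as `μ` and
`TV(ν, μ) ≤ ε` has `-log₂ 𝔼[max_a ν(a|Z)] ≥ k`, that is, `𝔼[max_a ν(a|Z)] ≤ 2 ^ (-k)`. -/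
def avgAchievable {A Z : Type*} (ε : ℝ) (μ : PMF (A × Z)) : Set ℝ :=
  {k | ∃ ν : PMF (A × Z), marginalZ ν = marginalZ μ ∧ tvDist ν μ ≤ ε ∧
    (∑' z, marginalZ ν z * (⨆ a, condProb ν a z)) ≤ ENNReal.ofReal ((2 : ℝ) ^ (-k))}

/-- The numbers `k` for which some `ν` with the same marginal of `Z` as `μ` and
`TV(ν, μ) ≤ ε` has `-log₂ ν(a|z) ≥ k`, that is, `ν(a|z) ≤ 2 ^ (-k)`, for all `a` and `z`. -/
def worstAchievable {A Z : Type*} (ε : ℝ) (μ : PMF (A × Z)) : Set ℝ :=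
  {k | ∃ ν : PMF (A × Z), marginalZ ν = marginalZ μ ∧ tvDist ν μ ≤ ε ∧
    ∀ a z, condProb ν a z ≤ ENNReal.ofReal ((2 : ℝ) ^ (-k))}

/-- Smooth average conditional min-entropy `H_min^ε(A|Z)`. -/
def smoothAvgMinEntropy {A Z : Type*} (ε : ℝ) (μ : PMF (A × Z)) : EReal :=
  sSup ((fun k : ℝ => (k : EReal)) '' avgAchievable ε μ)

/-- Smooth worst-case conditional min-entropy `H_min^{u,ε}(A|Z)`. -/
def smoothWorstMinEntropy {A Z : Type*} (ε : ℝ) (μ : PMF (A × Z)) : EReal :=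
  sSup ((fun k : ℝ => (k : EReal)) '' worstAchievable ε μ)

/-! ### The multi-round device -/

/-- Values of `(Aⁿ, (Xⁿ, Λ))`. -/
abbrev Outcome (n : ℕ) (L : Type*) : Type _ := (Fin n → Output) × ((Fin n → Input) × L)

/-- Values of the past `W_i = (A^{i-1}, X^{i-1})` before the round with (zero-based) index `i`. -/
abbrev History (i : ℕ) : Type := (Fin i → Output) × (Fin i → Input)

/-- The past of round `i` in a full run. -/
def past {n : ℕ} {L : Type*} (i : Fin n) (w : Outcome n L) : History i :=
  (fun j => w.1 (Fin.castLE i.isLt.le j), fun j => w.2.1 (Fin.castLE i.isLt.le j))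

/-- The event `W_i = h, Λ = l`. -/
def pastEvent {n : ℕ} {L : Type*} (i : Fin n) (h : History i) (l : L) : Set (Outcome n L) :=
  {w | past i w = h ∧ w.2.2 = l}

/-- The assumptions on the distribution `μ` of `AⁿXⁿΛ`, for a device with behaviour
`(corr i W_i Λ, energy i W_i Λ)` in round `i`. The conditional probabilities are written
in product form, so that they are only constrained where the condition has positive probability. -/
structure DeviceAssumptions {n : ℕ} {L : Type*} (μ : PMF (Outcome n L)) (p : Input → ℝ)
    (ωpk ωavg : Input → ℝ) (εω : ℝ)
    (corr energy : (i : Fin n) → History i → L → Input → ℝ) : Prop where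
  /-- `μ(X_i = x | W_i Λ) = p(x)` -/
  input : ∀ (i : Fin n) (h : History i) (l : L) (x : Input),
    prob μ (pastEvent i h l ∩ {w | w.2.1 i = x}) = p x * prob μ (pastEvent i h l)
  /-- `(E_i(W_i,Λ), ω_i(W_i,Λ)) ∈ 𝒬` -/
  quantum : ∀ (i : Fin n) (h : History i) (l : L), (corr i h l, energy i h l) ∈ quantumSet
  /-- `μ(A_i = a | X_i = x, W_i Λ) = (1 + a E_{x,i}(W_i,Λ)) / 2` -/
  output : ∀ (i : Fin n) (h : History i) (l : L) (x : Input) (a : Output),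
    prob μ (pastEvent i h l ∩ {w | w.2.1 i = x} ∩ {w | w.1 i = a}) =
      (1 + outVal a * corr i h l x) / 2 * prob μ (pastEvent i h l ∩ {w | w.2.1 i = x})
  /-- max-peak assumption -/
  maxPeak : ∀ (i : Fin n) (h : History i) (l : L) (x : Input), energy i h l x ≤ ωpk x
  /-- max-average assumption -/
  maxAverage : 1 - εω ≤
    prob μ {w | ∀ x, (1 / (n : ℝ)) * ∑ i, energy i (past i w) w.2.2 x ≤ ωavg x}

/-! ### Trade-off functions and the protocol -/

/-- `H(E) = -∑_{a,x} p(x) (1 + a E_x)/2 log₂ ((1 + a E_x)/2)`. -/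
def condEntropy (p E : Input → ℝ) : ℝ :=
  -∑ a : Output, ∑ x : Input,
    p x * ((1 + outVal a * E x) / 2) * Real.logb 2 ((1 + outVal a * E x) / 2)

/-- Trade-off functions with max-peak energies `ωpk`. -/
def IsTradeOff (p ωpk α β γ : Input → ℝ) : Prop :=
  (∀ x, γ x ≤ 0) ∧
  ∀ E ω : Input → ℝ, (E, ω) ∈ quantumSet → (∀ x, ω x ≤ ωpk x) →
    ∑ x, α x + ∑ x, β x * E x + ∑ x, γ x * ω x ≤ condEntropy p E

/-- The arguments of the protocol (other than the number of rounds and the extractor). -/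
structure ProtocolArgs where
  /-- input distribution -/
  p : Input → ℝ
  /-- peak energy thresholds -/
  ωpk : Input → ℝ
  /-- average energy thresholds -/
  ωavg : Input → ℝ
  εω : ℝ
  εt : ℝ
  εm : ℝ
  α : Input → ℝ
  β : Input → ℝ
  γ : Input → ℝ
  /-- threshold of the test -/
  r : ℝ

namespace ProtocolArgs

variable (P : ProtocolArgs)

/-- The estimator `ξ(a,x) = (α_x + a β_x) / p(x)`. -/
def xi (a : Output) (x : Input) : ℝ := (1 / P.p x) * (P.α x + outVal a * P.β x)

/-- `ξ⁺ = max_{a,x} ξ(a,x)`. -/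
def xiMax : ℝ :=
  (Finset.univ : Finset (Output × Input)).sup' Finset.univ_nonempty fun q => P.xi q.1 q.2

/-- `ξ⁻ = min_{a,x} ξ(a,x)`. -/
def xiMin : ℝ :=
  (Finset.univ : Finset (Output × Input)).inf' Finset.univ_nonempty fun q => P.xi q.1 q.2

/-- `γ̄ = ∑ x, γ_x`. -/
def gammaBar : ℝ := ∑ x, P.γ x

/-- The second-moment bound `V`. -/
def V : ℝ :=
  max ((P.xiMax + P.gammaBar) ^ 2) ((P.xiMin + P.gammaBar) ^ 2)
    + 2 * max (-(Real.logb 2 (Fintype.card Output) * (P.gammaBar + P.xiMin))) 0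
    + 4 * (Fintype.card Output : ℝ) / Real.exp 1 ^ 2 * Real.logb 2 (Real.exp 1) ^ 2

/-- The error term `t`. -/
def t (n : ℕ) : ℝ :=
  √(2 * P.V) * √(Real.logb 2 (1 / P.εt) / n) + P.xiMax / 3 * (Real.logb 2 (1 / P.εt) / n)

/-- The min-entropy `σ_h` for which the extractor of the protocol is chosen. -/
def sigmaH (n : ℕ) : ℝ :=
  n * (P.r - √(2 * P.V) * √(Real.logb 2 (1 / P.εt) / n)
    - P.xiMax / 3 * (Real.logb 2 (1 / P.εt) / n) - Real.logb 2 (1 / P.εm) / n)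

/-- Validity of the arguments for `n` rounds. -/
structure Valid (n : ℕ) : Prop where
  rounds_pos : 1 ≤ n
  p_pos : ∀ x, 0 < P.p x
  p_sum : ∑ x, P.p x = 1
  ωavg_nonneg : ∀ x, 0 ≤ P.ωavg x
  ωavg_le_ωpk : ∀ x, P.ωavg x ≤ P.ωpk x
  ωpk_le_one : ∀ x, P.ωpk x ≤ 1
  εω_nonneg : 0 ≤ P.εω
  εt_pos : 0 < P.εt
  εt_le_one : P.εt ≤ 1
  εm_pos : 0 < P.εm
  εm_le_one : P.εm ≤ 1
  tradeOff : IsTradeOff P.p P.ωpk P.α P.β P.γ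
  xiMax_nonneg : 0 ≤ P.xiMax
  r_sub_t_le_one : P.r - P.t n ≤ 1

/-- The event that the test `⟨ξ⟩ + γ · ω_avg ≥ r` is passed. -/
def passEvent (n : ℕ) (L : Type*) : Set (Outcome n L) :=
  {w | P.r ≤ (1 / (n : ℝ)) * ∑ i, P.xi (w.1 i) (w.2.1 i) + ∑ x, P.γ x * P.ωavg x}

end ProtocolArgs

end SemiDI

end

/-!
By the chain rule, `μ(Aⁿ | XⁿΛ)` is the product of the round probabilities
`Pᵢ = μ(Aᵢ | Xᵢ, Wᵢ, Λ)`. The trade-off inequality says that the increments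
`ξ(Aᵢ, Xᵢ) + γ · ωᵢ + log₂ Pᵢ` have nonpositive conditional mean given the past; they are bounded
above by `ξ⁺`, and their conditional second moment is at most `V`. Bernstein's inequality for
supermartingales then bounds their sum by `n t` up to probability `εt`. On the runs that also
satisfy the average energy constraint and pass the test, this gives
`μ(Aⁿ | XⁿΛ) ≤ 2 ^ (-n (r - t))`.

After conditioning on the test, the mass of the remaining runs is spread, within each value of
`(Xⁿ, Λ)`, over the outputs that lie below the bound, which keeps the marginal. There is room for
it because `r - t ≤ 1` makes the bound at least the uniform probability `2 ^ (-n)`. For the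
worst-case entropy one also moves the values of `(Xⁿ, Λ)` whose probability drops, under the
conditioning, below `εm / κ` times its original value; together they carry conditional mass at most
`εm / κ`.
-/

noncomputable section

namespace SemiDI

section ElementaryInequalities

theorem negMulLog_le_exp_neg_one {x : ℝ} (hx : 0 ≤ x) : Real.negMulLog x ≤ Real.exp (-1) := by
  rcases hx.eq_or_lt with rfl | hx
  · simpa using (Real.exp_pos (-1)).le
  · simpa [Real.negMulLog, Real.exp_log hx, mul_comm] using
      Real.mul_exp_neg_le_exp_neg_one (-Real.log x)

theorem mul_log_sq_le {x : ℝ} (hx : 0 ≤ x) (hx1 : x ≤ 1) :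
    x * Real.log x ^ 2 ≤ 4 * Real.exp (-1) ^ 2 := by
  have hsqrt : √x ^ 2 = x := Real.sq_sqrt hx
  calc x * Real.log x ^ 2
      = 4 * Real.negMulLog √x ^ 2 := by
        rw [Real.negMulLog, Real.log_sqrt hx]
        linear_combination (-Real.log x ^ 2) * hsqrt
    _ ≤ 4 * Real.exp (-1) ^ 2 := by
        gcongr
        · exact Real.negMulLog_nonneg (Real.sqrt_nonneg x) (Real.sqrt_le_one.2 hx1)
        · exact negMulLog_le_exp_neg_one (Real.sqrt_nonneg x)

theorem mul_log_sq_le_of_half_le {x : ℝ} (hx : 1 / 2 ≤ x) (hx1 : x ≤ 1) :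
    x * Real.log x ^ 2 ≤ Real.log 2 * Real.exp (-1) := by
  have hlog_ge : -Real.log x ≤ Real.log 2 := by
    rw [← Real.log_inv]
    exact Real.log_le_log (by positivity) (inv_le_of_inv_le₀ (by norm_num) (by linarith))
  calc x * Real.log x ^ 2 = -Real.log x * Real.negMulLog x := by rw [Real.negMulLog]; ring
    _ ≤ Real.log 2 * Real.exp (-1) :=
        mul_le_mul hlog_ge (negMulLog_le_exp_neg_one (by linarith))
          (Real.negMulLog_nonneg (by linarith) hx1) (Real.log_nonneg (by norm_num))

theorem binary_log_sq_le {q : ℝ} (hq : 0 ≤ q) (hq1 : q ≤ 1) :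
    q * Real.log q ^ 2 + (1 - q) * Real.log (1 - q) ^ 2
      ≤ 4 * Real.exp (-1) ^ 2 + Real.log 2 * Real.exp (-1) := by
  rcases le_total (1 / 2) q with h | h
  · rw [add_comm]
    exact add_le_add (mul_log_sq_le (by linarith) (by linarith)) (mul_log_sq_le_of_half_le h hq1)
  · exact add_le_add (mul_log_sq_le hq hq1) (mul_log_sq_le_of_half_le (by linarith) (by linarith))

theorem log_two_mul_exp_neg_one_add_le :
    Real.log 2 * Real.exp (-1) + Real.log 2 ^ 2 / 4 ≤ 4 * Real.exp (-1) ^ 2 := by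
  have hlog := Real.log_two_lt_d9
  have hexp := Real.exp_neg_one_gt_d9
  have hlog0 : 0 < Real.log 2 := Real.log_pos (by norm_num)
  nlinarith

theorem binary_logb_sq_le {q : ℝ} (hq : 0 ≤ q) (hq1 : q ≤ 1) :
    q * Real.logb 2 q ^ 2 + (1 - q) * Real.logb 2 (1 - q) ^ 2 + 1 / 4
      ≤ 4 * 2 / Real.exp 1 ^ 2 * Real.logb 2 (Real.exp 1) ^ 2 := by
  calc q * Real.logb 2 q ^ 2 + (1 - q) * Real.logb 2 (1 - q) ^ 2 + 1 / 4
      = (q * Real.log q ^ 2 + (1 - q) * Real.log (1 - q) ^ 2 + Real.log 2 ^ 2 / 4)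
          / Real.log 2 ^ 2 := by
        simp only [Real.logb]; field_simp
    _ ≤ 8 * Real.exp (-1) ^ 2 / Real.log 2 ^ 2 := by
        gcongr
        linarith [binary_log_sq_le hq hq1, log_two_mul_exp_neg_one_add_le]
    _ = 4 * 2 / Real.exp 1 ^ 2 * Real.logb 2 (Real.exp 1) ^ 2 := by
        rw [Real.logb, Real.log_exp, Real.exp_neg]; field_simp; norm_num

theorem exp_le_quadratic_of_nonpos {y : ℝ} (hy : y ≤ 0) : Real.exp y ≤ 1 + y + y ^ 2 / 2 := by
  have hpos : 0 < 1 + -y + (-y) ^ 2 / 2 := by nlinarith [sq_nonneg y]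
  have hinv : (1 + -y + (-y) ^ 2 / 2) * Real.exp y ≤ 1 := by
    have hneg := Real.quadratic_le_exp_of_nonneg (neg_nonneg.2 hy)
    rwa [Real.exp_neg, le_inv_comm₀ hpos (Real.exp_pos y), ← one_div, le_div_iff₀ hpos,
      mul_comm] at hneg
  refine le_of_mul_le_mul_left (hinv.trans ?_) hpos
  nlinarith [sq_nonneg (y ^ 2)]

theorem exp_le_of_nonneg_of_lt_three {y : ℝ} (hy : 0 ≤ y) (hy3 : y < 3) :
    Real.exp y ≤ 1 + y + y ^ 2 / (2 * (1 - y / 3)) := by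
  have hexp : HasSum (fun k : ℕ ↦ y ^ k / (k.factorial : ℝ)) (Real.exp y) := by
    rw [Real.exp_eq_exp_ℝ]
    exact NormedSpace.expSeries_div_hasSum_exp y
  have hgeom : HasSum (fun k : ℕ ↦ y ^ 2 / 2 * (y / 3) ^ k) (y ^ 2 / 2 * (1 - y / 3)⁻¹) :=
    (hasSum_geometric_of_lt_one (by positivity) (by linarith)).mul_left _
  have hterm (k : ℕ) : y ^ (k + 2) / ((k + 2).factorial : ℝ) ≤ y ^ 2 / 2 * (y / 3) ^ k :=
    calc y ^ (k + 2) / ((k + 2).factorial : ℝ) ≤ y ^ (k + 2) / (2 * 3 ^ k) := by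
          gcongr
          rw [add_comm k 2]
          exact_mod_cast Nat.factorial_mul_pow_le_factorial (m := 2) (n := k)
      _ = y ^ 2 / 2 * (y / 3) ^ k := by rw [div_pow, pow_add]; field_simp
  have htail := hasSum_le hterm ((hasSum_nat_add_iff' 2).2 hexp) hgeom
  rw [Finset.sum_range_succ, Finset.sum_range_one] at htail
  rw [← div_div, div_eq_mul_inv (y ^ 2 / 2)]
  norm_num at htail
  linarith

theorem exp_le_bernstein {y B : ℝ} (hB : 0 ≤ B) (hB3 : B < 3) (hy : y ≤ B) :
    Real.exp y ≤ 1 + y + y ^ 2 / (2 * (1 - B / 3)) := by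
  rcases le_total y 0 with h | h
  · refine (exp_le_quadratic_of_nonpos h).trans ?_
    gcongr
    · linarith
    · linarith
  · refine (exp_le_of_nonneg_of_lt_three h (hy.trans_lt hB3)).trans ?_
    gcongr
    linarith

theorem exists_bernstein_exponent {v c l : ℝ} (hv : 0 < v) (hc : 0 ≤ c) (hl : 0 ≤ l) :
    ∃ lam, 0 ≤ lam ∧ lam * c < 1 ∧
      lam ^ 2 * v / (2 * (1 - lam * c)) - lam * (√(2 * v * l) + c * l) = -l := by
  set w := √(2 * l / v) with hw
  have hw0 : 0 ≤ w := Real.sqrt_nonneg _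
  have hw2 : w ^ 2 * v = 2 * l := by
    rw [hw, Real.sq_sqrt (by positivity)]; field_simp
  have hsqrt : √(2 * v * l) = w * v := by
    rw [show 2 * v * l = (w * v) ^ 2 by linear_combination (-v) * hw2]
    exact Real.sqrt_sq (by positivity)
  have hden : 0 < 1 + c * w := by positivity
  have hcompl : 1 - w / (1 + c * w) * c = 1 / (1 + c * w) := by field_simp; ring
  refine ⟨w / (1 + c * w), by positivity, ?_, ?_⟩
  · linarith [one_div_pos.2 hden]
  · rw [hcompl, hsqrt]
    field_simp
    linear_combination (-1 : ℝ) * hw2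

end ElementaryInequalities

section Moments

variable {ι : Type*} [Fintype ι] {π X u : ι → ℝ}

theorem sum_mul_exp_le_bernstein {b V lam : ℝ}
    (hπ : ∀ i, 0 ≤ π i) (hπ1 : ∑ i, π i = 1) (hX : ∀ i, X i ≤ b) (hb : 0 ≤ b)
    (hmean : ∑ i, π i * X i ≤ 0) (hV : ∑ i, π i * X i ^ 2 ≤ V)
    (hlam : 0 ≤ lam) (hlamb : lam * b < 3) :
    ∑ i, π i * Real.exp (lam * X i) ≤ Real.exp (lam ^ 2 * V / (2 * (1 - lam * b / 3))) := by
  have hden : 0 < 2 * (1 - lam * b / 3) := by linarith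
  calc ∑ i, π i * Real.exp (lam * X i)
      ≤ ∑ i, π i * (1 + lam * X i + (lam * X i) ^ 2 / (2 * (1 - lam * b / 3))) := by
        gcongr with i _
        · exact hπ i
        · exact exp_le_bernstein (by positivity) hlamb (mul_le_mul_of_nonneg_left (hX i) hlam)
    _ = ∑ i, π i + lam * ∑ i, π i * X i
          + lam ^ 2 * (∑ i, π i * X i ^ 2) / (2 * (1 - lam * b / 3)) := by
        rw [Finset.mul_sum, Finset.mul_sum, Finset.sum_div, ← Finset.sum_add_distrib,
          ← Finset.sum_add_distrib]
        exact Finset.sum_congr rfl fun i _ ↦ by ring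
    _ ≤ 1 + 0 + lam ^ 2 * V / (2 * (1 - lam * b / 3)) := by
        gcongr
        · exact hπ1.le
        · exact mul_nonpos_of_nonneg_of_nonpos hlam hmean
    _ ≤ Real.exp (lam ^ 2 * V / (2 * (1 - lam * b / 3))) := by
        rw [add_zero, add_comm]
        exact Real.add_one_le_exp _

theorem sum_mul_sub_sq_le {a b : ℝ} (hπ : ∀ i, 0 ≤ π i) (hπ1 : ∑ i, π i = 1)
    (hX : ∀ i, X i ∈ Set.Icc a b) (hu : ∀ i, 0 ≤ u i) :
    ∑ i, π i * (X i - u i) ^ 2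
      ≤ (a + b) * ∑ i, π i * X i - a * b - 2 * a * ∑ i, π i * u i + ∑ i, π i * u i ^ 2 := by
  have hpoint (i : ι) : (X i - u i) ^ 2 ≤ (a + b) * X i - a * b - 2 * a * u i + u i ^ 2 := by
    have hchord : 0 ≤ (X i - a) * (b - X i) :=
      mul_nonneg (sub_nonneg.2 (hX i).1) (sub_nonneg.2 (hX i).2)
    have hcross : 0 ≤ (X i - a) * u i := mul_nonneg (sub_nonneg.2 (hX i).1) (hu i)
    linarith
  calc ∑ i, π i * (X i - u i) ^ 2
      ≤ ∑ i, π i * ((a + b) * X i - a * b - 2 * a * u i + u i ^ 2) := by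
        gcongr with i _
        · exact hπ i
        · exact hpoint i
    _ = (a + b) * ∑ i, π i * X i - (∑ i, π i) * (a * b) - 2 * a * ∑ i, π i * u i
          + ∑ i, π i * u i ^ 2 := by
        simp only [Finset.mul_sum, Finset.sum_mul, ← Finset.sum_sub_distrib,
          ← Finset.sum_add_distrib]
        exact Finset.sum_congr rfl fun i _ ↦ by ring
    _ = _ := by rw [hπ1, one_mul]

-- The slack `1 / 4` pays for the shift by `d`; it is the room that the loose constant
-- `4 |A| / e²` in `V` leaves over a binary alphabet.
theorem chord_le_max_sq {a b d m h : ℝ} (hab : a ≤ b) (hd : 0 ≤ d) (ham : a + d ≤ m)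
    (hmh : m ≤ h) (h1 : h ≤ 1) :
    (a + d + (b + d)) * m - (a + d) * (b + d) - 2 * (a + d) * h
      ≤ max (b ^ 2) (a ^ 2) + 2 * max (-a) 0 + 1 / 4 := by
  have hb2 := le_max_left (b ^ 2) (a ^ 2)
  have ha2 := le_max_right (b ^ 2) (a ^ 2)
  have hneg := le_max_left (-a) 0
  have hneg0 := le_max_right (-a) 0
  rcases lt_or_ge (a + d + (b + d)) 0 with hsum | hsum
  · have hchord : (a + d + (b + d)) * m ≤ (a + d + (b + d)) * (a + d) :=
      mul_le_mul_of_nonpos_left ham hsum.le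
    have hcross : -(a + d) * h ≤ -(a + d) := mul_le_of_le_one_right (by linarith) h1
    have hsq : (a + d) ^ 2 ≤ a ^ 2 := by nlinarith
    linarith
  · have hchord : (a + d + (b + d)) * m ≤ (a + d + (b + d)) * h :=
      mul_le_mul_of_nonneg_left hmh hsum
    have hcross : (b - a) * h ≤ b - a := mul_le_of_le_one_right (by linarith) h1
    rcases le_total b (-a) with hba | hba
    · have hprod : -((a + d) * (b + d)) ≤ ((b - a) / 2) ^ 2 := by
        nlinarith [sq_nonneg (a + d + (b + d))]
      have hsq : ((b - a) / 2) ^ 2 ≤ a ^ 2 := by nlinarith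
      linarith
    · have hprod : -((a + d) * (b + d)) ≤ -(a * b) := by nlinarith
      have hba2 : -(a * b) + (b - a) ≤ b ^ 2 + 2 * max (-a) 0 + 1 / 4 := by
        rcases le_total 0 a with ha | ha
        · nlinarith [sq_nonneg (b - 1 / 2), mul_nonneg ha (ha.trans hab)]
        · nlinarith [sq_nonneg (a + b - 1 / 2)]
      linarith

theorem sum_mul_sub_sq_le_max {a b d K : ℝ} (hab : a ≤ b) (hd : 0 ≤ d)
    (hπ : ∀ i, 0 ≤ π i) (hπ1 : ∑ i, π i = 1)
    (hX : ∀ i, X i ∈ Set.Icc (a + d) (b + d)) (hu : ∀ i, 0 ≤ u i)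
    (hmean : ∑ i, π i * X i ≤ ∑ i, π i * u i)
    (hu1 : ∑ i, π i * u i ≤ 1) (hu2 : ∑ i, π i * u i ^ 2 + 1 / 4 ≤ K) :
    ∑ i, π i * (X i - u i) ^ 2 ≤ max (b ^ 2) (a ^ 2) + 2 * max (-a) 0 + K := by
  have hmin : a + d ≤ ∑ i, π i * X i :=
    calc a + d = ∑ i, π i * (a + d) := by rw [← Finset.sum_mul, hπ1, one_mul]
      _ ≤ ∑ i, π i * X i :=
        Finset.sum_le_sum fun i _ ↦ mul_le_mul_of_nonneg_left (hX i).1 (hπ i)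
  linarith [sum_mul_sub_sq_le hπ hπ1 hX hu, chord_le_max_sq hab hd hmin hmean hu1]

end Moments

section Energies

theorem EnergyObservable.eigenvalue_nonneg {H : Type} [NormedAddCommGroup H]
    [InnerProductSpace ℂ H] (O : EnergyObservable H) (i : O.ι) : 0 ≤ O.eigenvalue i := by
  by_cases h : i = O.vacuum
  · rw [h, O.eigenvalue_vacuum]
  · exact zero_le_one.trans (O.one_le_eigenvalue i h)

theorem IsRealisable.energy_nonneg {q : Behaviour} (hq : IsRealisable q) (x : Input) :
    0 ≤ q.2 x := by
  obtain ⟨H, _, _, _, O, ρ, M, hρ, -, -, -, hω⟩ := hq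
  obtain ⟨e, he, hle⟩ := hω x
  refine (he.nonneg fun i ↦ mul_nonneg (O.eigenvalue_nonneg i) ?_).trans hle
  simpa using (hρ x).1.re_inner_nonneg_right (O.basis i)

theorem energy_nonneg_of_mem_quantumSet {q : Behaviour} (hq : q ∈ quantumSet) (x : Input) :
    0 ≤ q.2 x := by
  have hconvex : Convex ℝ {q : Behaviour | ∀ x, 0 ≤ q.2 x} :=
    fun q hq q' hq' a b ha hb _ x ↦ add_nonneg (mul_nonneg ha (hq x)) (mul_nonneg hb (hq' x))
  exact convexHull_min (fun _ hq x ↦ hq.energy_nonneg x) hconvex hq x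

end Energies

section SingleRound

variable {p E : Input → ℝ}

theorem sum_output (f : Output → ℝ) : ∑ a, f a = f 1 + f (-1) := by
  rw [show (Finset.univ : Finset Output) = {1, -1} by decide, Finset.sum_pair (by decide)]

/-- The probability `(1 + a E_x) / 2` of output `a` on input `x` for the correlations `E`. -/
def outProb (E : Input → ℝ) (a : Output) (x : Input) : ℝ := (1 + outVal a * E x) / 2

theorem outProb_neg_one (E : Input → ℝ) (x : Input) : outProb E (-1) x = 1 - outProb E 1 x := by
  simp only [outProb, outVal, Units.val_neg, Units.val_one]
  push_cast
  ring

theorem sum_outProb (E : Input → ℝ) (x : Input) : ∑ a, outProb E a x = 1 := by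
  rw [sum_output, outProb_neg_one, add_sub_cancel]

theorem sum_outProb_mul_outVal (E : Input → ℝ) (x : Input) :
    ∑ a, outProb E a x * outVal a = E x := by
  rw [sum_output]
  simp only [outProb, outVal, Units.val_neg, Units.val_one]
  push_cast
  ring

theorem outProb_le_one {x : Input} (hE : ∀ a, 0 ≤ outProb E a x) (a : Output) :
    outProb E a x ≤ 1 := by
  rw [← sum_outProb E x]
  exact Finset.single_le_sum (fun b _ ↦ hE b) (Finset.mem_univ a)

theorem sum_outProb_mul_neg_logb_le_one (E : Input → ℝ) (x : Input) :
    ∑ a, outProb E a x * -Real.logb 2 (outProb E a x) ≤ 1 := by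
  calc ∑ a, outProb E a x * -Real.logb 2 (outProb E a x)
      = Real.binEntropy (outProb E 1 x) / Real.log 2 := by
        rw [sum_output, outProb_neg_one, Real.binEntropy, Real.log_inv, Real.log_inv]
        simp only [Real.logb]
        ring
    _ ≤ 1 := (div_le_one (Real.log_pos (by norm_num))).2 Real.binEntropy_le_log_two

theorem sum_outProb_mul_logb_sq_le {x : Input} (hE : ∀ a, 0 ≤ outProb E a x) :
    ∑ a, outProb E a x * Real.logb 2 (outProb E a x) ^ 2 + 1 / 4
      ≤ 4 * 2 / Real.exp 1 ^ 2 * Real.logb 2 (Real.exp 1) ^ 2 := by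
  rw [sum_output, outProb_neg_one]
  exact binary_logb_sq_le (hE 1) (outProb_le_one hE 1)

/-- The joint distribution `p(x) P(a|x)` of output and input in a round with correlations `E`. -/
def jointProb (p E : Input → ℝ) (q : Output × Input) : ℝ := p q.2 * outProb E q.1 q.2

theorem jointProb_nonneg (hp : ∀ x, 0 ≤ p x) (hE : ∀ a x, 0 ≤ outProb E a x)
    (q : Output × Input) : 0 ≤ jointProb p E q :=
  mul_nonneg (hp q.2) (hE q.1 q.2)

theorem sum_jointProb_mul (p E : Input → ℝ) (f : Output × Input → ℝ) :
    ∑ q, jointProb p E q * f q = ∑ x, p x * ∑ a, outProb E a x * f (a, x) := by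
  simp only [Fintype.sum_prod_type_right, Finset.mul_sum, jointProb, mul_assoc]

theorem sum_jointProb (hp1 : ∑ x, p x = 1) (E : Input → ℝ) : ∑ q, jointProb p E q = 1 := by
  simpa only [mul_one, sum_outProb, hp1] using sum_jointProb_mul p E fun _ ↦ 1

theorem sum_jointProb_mul_le {f : Output × Input → ℝ} {C : ℝ} (hp : ∀ x, 0 ≤ p x)
    (hp1 : ∑ x, p x = 1) (hf : ∀ x, ∑ a, outProb E a x * f (a, x) ≤ C) :
    ∑ q, jointProb p E q * f q ≤ C :=
  calc ∑ q, jointProb p E q * f q = ∑ x, p x * ∑ a, outProb E a x * f (a, x) :=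
        sum_jointProb_mul p E f
    _ ≤ ∑ x, p x * C :=
        Finset.sum_le_sum fun x _ ↦ mul_le_mul_of_nonneg_left (hf x) (hp x)
    _ = C := by rw [← Finset.sum_mul, hp1, one_mul]

theorem sum_jointProb_mul_logb (p E : Input → ℝ) :
    ∑ q, jointProb p E q * Real.logb 2 (outProb E q.1 q.2) = -condEntropy p E := by
  rw [condEntropy, neg_neg, Fintype.sum_prod_type]
  rfl

end SingleRound

namespace ProtocolArgs

variable (P : ProtocolArgs)

theorem xi_le_xiMax (a : Output) (x : Input) : P.xi a x ≤ P.xiMax :=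
  Finset.le_sup' (fun q : Output × Input ↦ P.xi q.1 q.2) (Finset.mem_univ (a, x))

theorem xiMin_le_xi (a : Output) (x : Input) : P.xiMin ≤ P.xi a x :=
  Finset.inf'_le (fun q : Output × Input ↦ P.xi q.1 q.2) (Finset.mem_univ (a, x))

theorem V_eq : P.V = max ((P.xiMax + P.gammaBar) ^ 2) ((P.xiMin + P.gammaBar) ^ 2)
    + 2 * max (-(P.xiMin + P.gammaBar)) 0
    + 4 * 2 / Real.exp 1 ^ 2 * Real.logb 2 (Real.exp 1) ^ 2 := by
  have hlogb : Real.logb 2 2 = 1 := Real.logb_self_eq_one (by norm_num)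
  simp only [V, Fintype.card_units_int, Nat.cast_ofNat, hlogb, one_mul, add_comm P.gammaBar]

theorem V_pos : 0 < P.V := by
  rw [V_eq]
  have hlogb : 0 < Real.logb 2 (Real.exp 1) :=
    Real.logb_pos (by norm_num) (Real.one_lt_exp_iff.2 one_pos)
  positivity

/-- The increment `ξ(a,x) + c + log₂ P(a|x)` of the supermartingale behind the test, for a round
with correlations `E`; the energies enter through `c = γ · ω`. -/
def increment (E : Input → ℝ) (c : ℝ) (q : Output × Input) : ℝ :=
  P.xi q.1 q.2 + c + Real.logb 2 (outProb E q.1 q.2)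

variable {P} {E : Input → ℝ} {c : ℝ}

theorem sum_jointProb_mul_xi (hp : ∀ x, 0 < P.p x) (E : Input → ℝ) :
    ∑ q, jointProb P.p E q * P.xi q.1 q.2 = ∑ x, P.α x + ∑ x, P.β x * E x := by
  rw [sum_jointProb_mul, ← Finset.sum_add_distrib]
  refine Finset.sum_congr rfl fun x _ ↦ ?_
  have hpx := (hp x).ne'
  calc P.p x * ∑ a, outProb E a x * P.xi a x
      = P.α x * ∑ a, outProb E a x + P.β x * ∑ a, outProb E a x * outVal a := by
        simp only [xi, Finset.mul_sum, ← Finset.sum_add_distrib]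
        exact Finset.sum_congr rfl fun a _ ↦ by field_simp
    _ = P.α x + P.β x * E x := by rw [sum_outProb, sum_outProb_mul_outVal, mul_one]

theorem sum_jointProb_mul_increment (hp : ∀ x, 0 < P.p x) (hp1 : ∑ x, P.p x = 1)
    (E : Input → ℝ) (c : ℝ) :
    ∑ q, jointProb P.p E q * P.increment E c q
      = ∑ x, P.α x + ∑ x, P.β x * E x + c - condEntropy P.p E := by
  simp only [increment, mul_add, Finset.sum_add_distrib, ← Finset.sum_mul]
  rw [sum_jointProb_mul_xi hp, sum_jointProb hp1, sum_jointProb_mul_logb]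
  ring

theorem increment_le_xiMax (hc : c ≤ 0) (hE : ∀ a x, 0 ≤ outProb E a x) (q : Output × Input) :
    P.increment E c q ≤ P.xiMax := by
  have hlogb : Real.logb 2 (outProb E q.1 q.2) ≤ 0 :=
    Real.logb_nonpos (by norm_num) (hE _ _) (outProb_le_one (fun a ↦ hE a _) _)
  rw [increment]
  linarith [P.xi_le_xiMax q.1 q.2]

theorem sum_jointProb_mul_increment_sq_le (hp : ∀ x, 0 ≤ P.p x) (hp1 : ∑ x, P.p x = 1)
    (hc : P.gammaBar ≤ c) (hE : ∀ a x, 0 ≤ outProb E a x)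
    (hmean : ∑ q, jointProb P.p E q * P.increment E c q ≤ 0) :
    ∑ q, jointProb P.p E q * P.increment E c q ^ 2 ≤ P.V := by
  let surprisal (q : Output × Input) : ℝ := -Real.logb 2 (outProb E q.1 q.2)
  have hincrement (q : Output × Input) :
      P.increment E c q = P.xi q.1 q.2 + c - surprisal q := by
    simp only [increment, surprisal, sub_neg_eq_add]
  have hsurprisal (q : Output × Input) : 0 ≤ surprisal q :=
    neg_nonneg.2 (Real.logb_nonpos (by norm_num) (hE _ _) (outProb_le_one (fun a ↦ hE a _) _))
  have hsurprisal_mean : ∑ q, jointProb P.p E q * surprisal q ≤ 1 :=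
    sum_jointProb_mul_le hp hp1 fun x ↦ sum_outProb_mul_neg_logb_le_one E x
  have hsurprisal_sq : ∑ q, jointProb P.p E q * surprisal q ^ 2
      ≤ 4 * 2 / Real.exp 1 ^ 2 * Real.logb 2 (Real.exp 1) ^ 2 - 1 / 4 :=
    sum_jointProb_mul_le hp hp1 fun x ↦ by
      simpa only [surprisal, neg_sq, ← le_sub_iff_add_le] using
        sum_outProb_mul_logb_sq_le fun a ↦ hE a x
  have hxi_mean : ∑ q, jointProb P.p E q * (P.xi q.1 q.2 + c)
      ≤ ∑ q, jointProb P.p E q * surprisal q := by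
    simpa only [hincrement, mul_sub, Finset.sum_sub_distrib, sub_nonpos] using hmean
  simp only [V_eq, hincrement]
  refine sum_mul_sub_sq_le_max (d := c - P.gammaBar) ?_ (sub_nonneg.2 hc)
    (jointProb_nonneg hp hE) (sum_jointProb hp1 E) (fun q ↦ ⟨?_, ?_⟩) hsurprisal hxi_mean
    hsurprisal_mean (le_sub_iff_add_le.1 hsurprisal_sq)
  · linarith [P.xiMin_le_xi 1 0, P.xi_le_xiMax 1 0]
  · linarith [P.xiMin_le_xi q.1 q.2]
  · linarith [P.xi_le_xiMax q.1 q.2]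

theorem sum_jointProb_mul_exp_increment_le (hp : ∀ x, 0 < P.p x) (hp1 : ∑ x, P.p x = 1)
    (hxi : 0 ≤ P.xiMax) (hc : P.gammaBar ≤ c) (hc0 : c ≤ 0) (hE : ∀ a x, 0 ≤ outProb E a x)
    (htrade : ∑ x, P.α x + ∑ x, P.β x * E x + c ≤ condEntropy P.p E)
    {lam : ℝ} (hlam : 0 ≤ lam) (hlam_lt : lam * P.xiMax < 3) :
    ∑ q, jointProb P.p E q * Real.exp (lam * P.increment E c q)
      ≤ Real.exp (lam ^ 2 * P.V / (2 * (1 - lam * P.xiMax / 3))) := by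
  have hp0 (x : Input) : 0 ≤ P.p x := (hp x).le
  have hmean : ∑ q, jointProb P.p E q * P.increment E c q ≤ 0 := by
    rw [sum_jointProb_mul_increment hp hp1]
    exact sub_nonpos.2 htrade
  exact sum_mul_exp_le_bernstein (jointProb_nonneg hp0 hE) (sum_jointProb hp1 E)
    (increment_le_xiMax hc0 hE) hxi hmean (sum_jointProb_mul_increment_sq_le hp0 hp1 hc hE hmean)
    hlam hlam_lt

theorem gammaBar_le_sum_mul (hγ : ∀ x, P.γ x ≤ 0) {ω : Input → ℝ} (hω : ∀ x, ω x ≤ 1) :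
    P.gammaBar ≤ ∑ x, P.γ x * ω x :=
  Finset.sum_le_sum fun x _ ↦ by
    simpa only [mul_one] using mul_le_mul_of_nonpos_left (hω x) (hγ x)

end ProtocolArgs

section Prob

variable {Ω : Type*} {μ : PMF Ω} {S : Set Ω}

theorem prob_nonneg (μ : PMF Ω) (S : Set Ω) : 0 ≤ prob μ S := ENNReal.toReal_nonneg

theorem toOuterMeasure_le_one (μ : PMF Ω) (S : Set Ω) : μ.toOuterMeasure S ≤ 1 := by
  rw [PMF.toOuterMeasure_apply, ← μ.tsum_coe]
  exact ENNReal.tsum_le_tsum fun w ↦ Set.indicator_le_self _ _ _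

theorem toOuterMeasure_ne_top (μ : PMF Ω) (S : Set Ω) : μ.toOuterMeasure S ≠ ⊤ :=
  ne_top_of_le_ne_top ENNReal.one_ne_top (toOuterMeasure_le_one μ S)

theorem toOuterMeasure_ne_zero (h : 0 < prob μ S) : μ.toOuterMeasure S ≠ 0 :=
  (ENNReal.toReal_pos_iff.1 h).1.ne'

theorem ofReal_prob (μ : PMF Ω) (S : Set Ω) : ENNReal.ofReal (prob μ S) = μ.toOuterMeasure S :=
  ENNReal.ofReal_toReal (toOuterMeasure_ne_top μ S)

theorem prob_mono (μ : PMF Ω) {S T : Set Ω} (h : S ⊆ T) : prob μ S ≤ prob μ T :=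
  ENNReal.toReal_mono (toOuterMeasure_ne_top μ T) (μ.toOuterMeasure.mono h)

theorem prob_singleton (μ : PMF Ω) (w : Ω) : prob μ {w} = (μ w).toReal := by
  rw [prob, PMF.toOuterMeasure_apply_singleton]

theorem prob_union_le (μ : PMF Ω) (S T : Set Ω) : prob μ (S ∪ T) ≤ prob μ S + prob μ T :=
  (ENNReal.toReal_mono
      (ENNReal.add_ne_top.2 ⟨toOuterMeasure_ne_top μ S, toOuterMeasure_ne_top μ T⟩)
      (MeasureTheory.measure_union_le S T)).trans ENNReal.toReal_add_le

theorem hasSum_toReal (μ : PMF Ω) : HasSum (fun w ↦ (μ w).toReal) 1 := by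
  have h := ENNReal.hasSum_toReal (f := μ) (by rw [μ.tsum_coe]; exact ENNReal.one_ne_top)
  rwa [← ENNReal.tsum_toReal_eq μ.apply_ne_top, μ.tsum_coe, ENNReal.toReal_one] at h

theorem hasSum_indicator_toReal (μ : PMF Ω) (S : Set Ω) :
    HasSum (S.indicator fun w ↦ (μ w).toReal) (prob μ S) := by
  have hcomp : (S.indicator fun w ↦ (μ w).toReal) = fun w ↦ (S.indicator μ w).toReal := by
    funext w
    by_cases hw : w ∈ S <;> simp [hw]
  have hfin : ∑' w, S.indicator μ w ≠ ⊤ := by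
    rw [← PMF.toOuterMeasure_apply]
    exact toOuterMeasure_ne_top μ S
  rw [hcomp, prob, PMF.toOuterMeasure_apply,
    ENNReal.tsum_toReal_eq (ENNReal.ne_top_of_tsum_ne_top hfin)]
  exact ENNReal.hasSum_toReal hfin

theorem prob_compl (μ : PMF Ω) (S : Set Ω) : prob μ Sᶜ = 1 - prob μ S := by
  have hsum := (hasSum_indicator_toReal μ S).add (hasSum_indicator_toReal μ Sᶜ)
  have hsplit (w : Ω) : S.indicator (fun w ↦ (μ w).toReal) w
      + Sᶜ.indicator (fun w ↦ (μ w).toReal) w = (μ w).toReal :=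
    congrFun (Set.indicator_self_add_compl S _) w
  simp only [hsplit] at hsum
  exact eq_sub_of_add_eq' (hsum.unique (hasSum_toReal μ))

theorem marginalZ_apply {A Z : Type*} [Fintype A] (ν : PMF (A × Z)) (z : Z) :
    marginalZ ν z = ∑ a, ν (a, z) := by
  classical
  rw [marginalZ, PMF.map_apply, ENNReal.tsum_prod', tsum_fintype]
  refine Finset.sum_congr rfl fun a _ ↦ ?_
  rw [tsum_eq_single z fun z' hz ↦ if_neg fun h ↦ hz h.symm, if_pos rfl]

theorem tsum_toOuterMeasure_fiber {β : Type*} (μ : PMF Ω) (f : Ω → β) :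
    ∑' y, μ.toOuterMeasure {w | f w = y} = 1 := by
  rw [← (μ.map f).tsum_coe]
  refine tsum_congr fun y ↦ ?_
  rw [← PMF.toOuterMeasure_apply_singleton, PMF.toOuterMeasure_map_apply]
  rfl

theorem toOuterMeasure_lt_le_tsum_mul_exp (μ : PMF Ω) (T : Ω → ℝ) (b : ℝ) {lam : ℝ}
    (hlam : 0 ≤ lam) :
    μ.toOuterMeasure {w | b < T w}
      ≤ (∑' w, μ w * ENNReal.ofReal (Real.exp (lam * T w)))
        * ENNReal.ofReal (Real.exp (-(lam * b))) := by
  rw [PMF.toOuterMeasure_apply, ← ENNReal.tsum_mul_right]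
  refine ENNReal.tsum_le_tsum fun w ↦ Set.indicator_apply_le' (fun hw ↦ ?_) fun _ ↦ zero_le
  have hle : b ≤ T w := hw.le
  rw [mul_assoc, ← ENNReal.ofReal_mul (Real.exp_pos _).le, ← Real.exp_add]
  refine le_mul_of_one_le_right zero_le (ENNReal.one_le_ofReal.2 (Real.one_le_exp ?_))
  nlinarith

theorem prob_lt_le_exp_neg_of_subgamma {T : Ω → ℝ} {v c l : ℝ} (hv : 0 < v) (hc : 0 ≤ c)
    (hl : 0 ≤ l)
    (hT : ∀ lam, 0 ≤ lam → lam * c < 1 → ∑' w, μ w * ENNReal.ofReal (Real.exp (lam * T w))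
      ≤ ENNReal.ofReal (Real.exp (lam ^ 2 * v / (2 * (1 - lam * c))))) :
    prob μ {w | √(2 * v * l) + c * l < T w} ≤ Real.exp (-l) := by
  obtain ⟨lam, hlam, hlam_lt, hexp⟩ := exists_bernstein_exponent hv hc hl
  refine ENNReal.toReal_le_of_le_ofReal (Real.exp_pos _).le ?_
  calc μ.toOuterMeasure {w | √(2 * v * l) + c * l < T w}
      ≤ _ := toOuterMeasure_lt_le_tsum_mul_exp μ T _ hlam
    _ ≤ _ := mul_le_mul_left (hT lam hlam hlam_lt) _
    _ = ENNReal.ofReal (Real.exp (-l)) := by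
      rw [← ENNReal.ofReal_mul (Real.exp_pos _).le, ← Real.exp_add, ← sub_eq_add_neg, hexp]

end Prob

namespace ProtocolArgs

variable {P : ProtocolArgs} {n : ℕ}

theorem mul_t_eq (P : ProtocolArgs) (hn : 1 ≤ n) :
    n * P.t n = √(2 * (n * P.V) * Real.logb 2 (1 / P.εt))
      + P.xiMax / 3 * Real.logb 2 (1 / P.εt) := by
  have hn0 : (0 : ℝ) < n := by exact_mod_cast hn
  have hV := P.V_pos
  have hsqrt (l : ℝ) : n * (√(2 * P.V) * √(l / n)) = √(2 * (n * P.V) * l) := by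
    calc n * (√(2 * P.V) * √(l / n)) = √(n ^ 2) * √(2 * P.V * (l / n)) := by
          rw [Real.sqrt_sq hn0.le, Real.sqrt_mul (x := 2 * P.V) (by positivity)]
      _ = √(2 * (n * P.V) * l) := by
          rw [← Real.sqrt_mul (by positivity)]
          congr 1
          field_simp
  rw [t, mul_add, hsqrt]
  congr 1
  field_simp

theorem sigmaH_eq (P : ProtocolArgs) (hn : 1 ≤ n) :
    n * (P.r - P.t n) - Real.logb 2 (1 / P.εm) = P.sigmaH n := by
  have hn0 : (n : ℝ) ≠ 0 := by exact_mod_cast (Nat.one_le_iff_ne_zero.1 hn)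
  rw [sigmaH, t, mul_sub (n : ℝ) _ (Real.logb 2 (1 / P.εm) / n), mul_div_cancel₀ _ hn0]
  ring

end ProtocolArgs

theorem exp_neg_logb_two_le {ε : ℝ} (h0 : 0 < ε) (h1 : ε ≤ 1) :
    Real.exp (-Real.logb 2 (1 / ε)) ≤ ε := by
  have hlog_two : Real.log 2 ≤ 1 := by linarith [Real.log_two_lt_d9]
  have hlog : Real.log ε ≤ 0 := Real.log_nonpos h0.le h1
  rw [← Real.le_log_iff_exp_le h0, Real.logb, one_div, Real.log_inv, neg_div, neg_neg,
    div_le_iff₀ (Real.log_pos one_lt_two)]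
  nlinarith

section AdaptedProducts

variable {R S : Type*} [CommSemiring R] [Fintype S] {n : ℕ}

theorem sum_prod_adapted_succ (g : (i : Fin (n + 1)) → (Fin i → S) → S → R) :
    ∑ s : Fin (n + 1) → S, ∏ i, g i (fun j ↦ s (Fin.castLE i.isLt.le j)) (s i) =
      ∑ s : Fin n → S,
        (∏ i : Fin n, g i.castSucc (fun j ↦ s (Fin.castLE i.isLt.le j)) (s i)) *
          ∑ t, g (Fin.last n) s t := by
  have hinit (s : Fin n → S) (t : S) (i : Fin n) :
      (Fin.snoc s t : Fin (n + 1) → S) i.castSucc = s i :=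
    Fin.snoc_castSucc (α := fun _ ↦ S) t s i
  have hlast (s : Fin n → S) (t : S) : (Fin.snoc s t : Fin (n + 1) → S) (Fin.last n) = t :=
    Fin.snoc_last (α := fun _ ↦ S) t s
  rw [← (Fin.snocEquiv fun _ : Fin (n + 1) ↦ S).sum_comp, Fintype.sum_prod_type_right]
  refine Finset.sum_congr rfl fun s _ ↦ ?_
  rw [Finset.mul_sum]
  refine Finset.sum_congr rfl fun t _ ↦ ?_
  rw [Fin.prod_univ_castSucc]
  refine congrArg₂ _ (Finset.prod_congr rfl fun i _ ↦ congrArg₂ _ ?_ (hinit s t i))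
    (congrArg₂ _ ?_ (hlast s t))
  · exact funext fun j ↦ hinit s t (Fin.castLE i.isLt.le j)
  · exact funext fun j ↦ hinit s t j

theorem sum_prod_adapted_eq_one (g : (i : Fin n) → (Fin i → S) → S → R)
    (hsum : ∀ i h, ∑ s, g i h s = 1) :
    ∑ s : Fin n → S, ∏ i, g i (fun j ↦ s (Fin.castLE i.isLt.le j)) (s i) = 1 := by
  induction n with
  | zero => simp
  | succ n ih =>
    rw [sum_prod_adapted_succ]
    simp only [hsum, mul_one]
    exact ih (fun i ↦ g i.castSucc) fun i ↦ hsum i.castSucc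

theorem sum_prod_adapted_le_pow [PartialOrder R] [IsOrderedRing R] {C : R} (hC : 0 ≤ C)
    (g : (i : Fin n) → (Fin i → S) → S → R) (hg : ∀ i h s, 0 ≤ g i h s)
    (hsum : ∀ i h, ∑ s, g i h s ≤ C) :
    ∑ s : Fin n → S, ∏ i, g i (fun j ↦ s (Fin.castLE i.isLt.le j)) (s i) ≤ C ^ n := by
  induction n with
  | zero => simp
  | succ n ih =>
    rw [sum_prod_adapted_succ, pow_succ]
    calc _ ≤ ∑ s : Fin n → S,
          (∏ i : Fin n, g i.castSucc (fun j ↦ s (Fin.castLE i.isLt.le j)) (s i)) * C :=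
        Finset.sum_le_sum fun s _ ↦ mul_le_mul_of_nonneg_left (hsum _ _)
          (Finset.prod_nonneg fun i _ ↦ hg _ _ _)
      _ ≤ C ^ n * C := by
        rw [← Finset.sum_mul]
        exact mul_le_mul_of_nonneg_right
          (ih (fun i ↦ g i.castSucc) (fun i ↦ hg i.castSucc) fun i ↦ hsum i.castSucc) hC

end AdaptedProducts

section ChainRule

variable {n : ℕ} {L : Type*}

/-- The runs that agree with `w` in `Λ` and in the first `k` rounds. -/
def prefixEvent (k : ℕ) (w : Outcome n L) : Set (Outcome n L) :=
  {w' | w'.2.2 = w.2.2 ∧ ∀ j : Fin n, (j : ℕ) < k → w'.1 j = w.1 j ∧ w'.2.1 j = w.2.1 j}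

theorem pastEvent_past_eq_prefixEvent (i : Fin n) (w : Outcome n L) :
    pastEvent i (past i w) w.2.2 = prefixEvent i w := by
  ext w'
  simp only [pastEvent, prefixEvent, past, Set.mem_ofPred_eq, Prod.mk.injEq, funext_iff]
  constructor
  · rintro ⟨⟨hA, hX⟩, hΛ⟩
    exact ⟨hΛ, fun j hj ↦ ⟨hA ⟨j, hj⟩, hX ⟨j, hj⟩⟩⟩
  · rintro ⟨hΛ, hAX⟩
    exact ⟨⟨fun j ↦ (hAX (Fin.castLE i.isLt.le j) j.isLt).1,
      fun j ↦ (hAX (Fin.castLE i.isLt.le j) j.isLt).2⟩, hΛ⟩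

theorem prefixEvent_succ (i : Fin n) (w : Outcome n L) :
    prefixEvent (i + 1) w =
      prefixEvent i w ∩ {w' | w'.2.1 i = w.2.1 i} ∩ {w' | w'.1 i = w.1 i} := by
  ext w'
  simp only [prefixEvent, Set.mem_ofPred_eq, Set.mem_inter_iff]
  constructor
  · rintro ⟨hΛ, hAX⟩
    exact ⟨⟨⟨hΛ, fun j hj ↦ hAX j (by omega)⟩, (hAX i (by omega)).2⟩, (hAX i (by omega)).1⟩
  · rintro ⟨⟨⟨hΛ, hAX⟩, hx⟩, ha⟩
    refine ⟨hΛ, fun j hj ↦ ?_⟩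
    rcases Nat.lt_succ_iff_lt_or_eq.1 hj with hj | hj
    · exact hAX j hj
    · obtain rfl : j = i := Fin.ext hj
      exact ⟨ha, hx⟩

theorem prefixEvent_zero (w : Outcome n L) : prefixEvent 0 w = {w' | w'.2.2 = w.2.2} := by
  simp [prefixEvent]

theorem prefixEvent_self (w : Outcome n L) : prefixEvent n w = {w} := by
  ext w'
  simp only [prefixEvent, Set.mem_ofPred_eq, Set.mem_singleton_iff]
  constructor
  · rintro ⟨hΛ, hAX⟩
    exact Prod.ext (funext fun j ↦ (hAX j j.isLt).1)
      (Prod.ext (funext fun j ↦ (hAX j j.isLt).2) hΛ)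
  · rintro rfl
    exact ⟨rfl, fun _ _ ↦ ⟨rfl, rfl⟩⟩

theorem prob_pastEvent_pos {μ : PMF (Outcome n L)} {w : Outcome n L} (hw : 0 < (μ w).toReal)
    (i : Fin n) : 0 < prob μ (pastEvent i (past i w) w.2.2) := by
  rw [← prob_singleton] at hw
  refine hw.trans_le (prob_mono μ ?_)
  rintro _ rfl
  exact ⟨rfl, rfl⟩

/-- Outcomes, listed by the value of `Λ` and the sequence of pairs `(Aᵢ, Xᵢ)`. -/
def outcomeEquiv (n : ℕ) (L : Type*) : L × (Fin n → Output × Input) ≃ Outcome n L where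
  toFun q := (fun i ↦ (q.2 i).1, fun i ↦ (q.2 i).2, q.1)
  invFun w := (w.2.2, fun i ↦ (w.1 i, w.2.1 i))
  left_inv _ := rfl
  right_inv _ := rfl

theorem tsum_outcome (F : Outcome n L → ℝ≥0∞) :
    ∑' w, F w = ∑' l, ∑ s : Fin n → Output × Input, F (outcomeEquiv n L (l, s)) := by
  rw [← (outcomeEquiv n L).tsum_eq, ENNReal.tsum_prod']
  simp only [tsum_fintype]

/-- The conditional probability `μ(Aᵢ | Xᵢ, Wᵢ, Λ)` of the output of round `i` of the run `w`,
for a device with correlations `corr`. -/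
def roundProb (corr : (i : Fin n) → History i → L → Input → ℝ) (w : Outcome n L) (i : Fin n) : ℝ :=
  outProb (corr i (past i w) w.2.2) (w.1 i) (w.2.1 i)

namespace DeviceAssumptions

variable {μ : PMF (Outcome n L)} {p ωpk ωavg : Input → ℝ} {εω : ℝ}
  {corr energy : (i : Fin n) → History i → L → Input → ℝ}

theorem outProb_nonneg (hμ : DeviceAssumptions μ p ωpk ωavg εω corr energy) (hp : ∀ x, 0 < p x)
    {i : Fin n} {h : History i} {l : L} (hpos : 0 < prob μ (pastEvent i h l)) (a : Output)
    (x : Input) : 0 ≤ outProb (corr i h l) a x := by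
  have hprob := prob_nonneg μ (pastEvent i h l ∩ {w | w.2.1 i = x} ∩ {w | w.1 i = a})
  rw [hμ.output, hμ.input] at hprob
  exact nonneg_of_mul_nonneg_left hprob (mul_pos (hp x) hpos)

theorem prob_prefixEvent_succ (hμ : DeviceAssumptions μ p ωpk ωavg εω corr energy)
    (i : Fin n) (w : Outcome n L) :
    prob μ (prefixEvent (i + 1) w)
      = prob μ (prefixEvent i w) * (p (w.2.1 i) * roundProb corr w i) := by
  rw [prefixEvent_succ, ← pastEvent_past_eq_prefixEvent, hμ.output, hμ.input, roundProb, outProb]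
  ring

theorem prob_prefixEvent (hμ : DeviceAssumptions μ p ωpk ωavg εω corr energy) (w : Outcome n L)
    {k : ℕ} (hk : k ≤ n) :
    prob μ (prefixEvent k w) = prob μ {w' | w'.2.2 = w.2.2} *
      ∏ i : Fin k, p (w.2.1 (Fin.castLE hk i)) * roundProb corr w (Fin.castLE hk i) := by
  induction k with
  | zero => simp [prefixEvent_zero]
  | succ k ih =>
    rw [Fin.prod_univ_castSucc, ← mul_assoc]
    refine (hμ.prob_prefixEvent_succ ⟨k, hk⟩ w).trans ?_
    rw [ih (Nat.le_of_succ_le hk)]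
    rfl

theorem toReal_apply (hμ : DeviceAssumptions μ p ωpk ωavg εω corr energy) (w : Outcome n L) :
    (μ w).toReal = prob μ {w' | w'.2.2 = w.2.2} * ∏ i, p (w.2.1 i) * roundProb corr w i := by
  have hfull := hμ.prob_prefixEvent w le_rfl
  rwa [prefixEvent_self, prob_singleton] at hfull

theorem toReal_marginalZ (hμ : DeviceAssumptions μ p ωpk ωavg εω corr energy)
    (z : (Fin n → Input) × L) :
    (marginalZ μ z).toReal = prob μ {w | w.2.2 = z.2} * ∏ i, p (z.1 i) := by
  have hsum : ∑ a : Fin n → Output, ∏ i, roundProb corr (a, z) i = 1 :=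
    sum_prod_adapted_eq_one
      (fun i h a ↦ outProb (corr i (h, fun j ↦ z.1 (Fin.castLE i.isLt.le j)) z.2) a (z.1 i))
      fun i h ↦ sum_outProb _ _
  rw [marginalZ_apply, ENNReal.toReal_sum fun a _ ↦ μ.apply_ne_top _]
  simp only [hμ.toReal_apply, Finset.prod_mul_distrib]
  rw [← Finset.mul_sum, ← Finset.mul_sum, hsum, mul_one]

theorem toReal_apply_eq_marginalZ_mul (hμ : DeviceAssumptions μ p ωpk ωavg εω corr energy)
    (w : Outcome n L) :
    (μ w).toReal = (marginalZ μ w.2).toReal * ∏ i, roundProb corr w i := by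
  rw [hμ.toReal_marginalZ, hμ.toReal_apply, Finset.prod_mul_distrib, mul_assoc]

end DeviceAssumptions

open Classical in
/-- The weight `μ(Aᵢ = a, Xᵢ = x | Wᵢ = h, Λ = l) * f i h l (a, x)`. It is set to `0` on pasts of
probability zero, where `outProb` is not constrained and may be negative. -/
def stepWeight (μ : PMF (Outcome n L)) (p : Input → ℝ)
    (corr : (i : Fin n) → History i → L → Input → ℝ)
    (f : (i : Fin n) → History i → L → Output × Input → ℝ)
    (i : Fin n) (h : History i) (l : L) (q : Output × Input) : ℝ :=
  if 0 < prob μ (pastEvent i h l) then jointProb p (corr i h l) q * f i h l q else 0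

namespace DeviceAssumptions

variable {μ : PMF (Outcome n L)} {p ωpk ωavg : Input → ℝ} {εω : ℝ}
  {corr energy : (i : Fin n) → History i → L → Input → ℝ}
  {f : (i : Fin n) → History i → L → Output × Input → ℝ} {C : ℝ}

theorem stepWeight_nonneg (hμ : DeviceAssumptions μ p ωpk ωavg εω corr energy)
    (hp : ∀ x, 0 < p x) (hf : ∀ i h l q, 0 ≤ f i h l q)
    (i : Fin n) (h : History i) (l : L) (q : Output × Input) :
    0 ≤ stepWeight μ p corr f i h l q := by
  rw [stepWeight]
  split_ifs with hpos
  · exact mul_nonneg (jointProb_nonneg (fun x ↦ (hp x).le) (hμ.outProb_nonneg hp hpos) q)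
      (hf i h l q)
  · exact le_rfl

theorem toReal_mul_prod_le (hμ : DeviceAssumptions μ p ωpk ωavg εω corr energy)
    (hp : ∀ x, 0 < p x) (hf : ∀ i h l q, 0 ≤ f i h l q) (w : Outcome n L) :
    (μ w).toReal * ∏ i, f i (past i w) w.2.2 (w.1 i, w.2.1 i)
      ≤ prob μ {w' | w'.2.2 = w.2.2} *
        ∏ i, stepWeight μ p corr f i (past i w) w.2.2 (w.1 i, w.2.1 i) := by
  rcases (ENNReal.toReal_nonneg (a := μ w)).eq_or_lt with hw | hw
  · rw [← hw, zero_mul]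
    exact mul_nonneg (prob_nonneg μ _)
      (Finset.prod_nonneg fun i _ ↦ hμ.stepWeight_nonneg hp hf _ _ _ _)
  · rw [hμ.toReal_apply, mul_assoc, ← Finset.prod_mul_distrib]
    exact (congrArg _ (Finset.prod_congr rfl fun i _ ↦ (if_pos (prob_pastEvent_pos hw i)).symm)).le

theorem sum_prod_stepWeight_le (hμ : DeviceAssumptions μ p ωpk ωavg εω corr energy)
    (hp : ∀ x, 0 < p x) (hf : ∀ i h l q, 0 ≤ f i h l q) (hC : 0 ≤ C) (l : L)
    (hstep : ∀ i h, 0 < prob μ (pastEvent i h l) →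
      ∑ q, jointProb p (corr i h l) q * f i h l q ≤ C) :
    ∑ s : Fin n → Output × Input, ∏ i,
      stepWeight μ p corr f i (past i (outcomeEquiv n L (l, s))) l (s i) ≤ C ^ n := by
  refine sum_prod_adapted_le_pow hC
    (fun i h ↦ stepWeight μ p corr f i (fun j ↦ (h j).1, fun j ↦ (h j).2) l)
    (fun i h ↦ hμ.stepWeight_nonneg hp hf i _ l) fun i h ↦ ?_
  simp only [stepWeight]
  split_ifs with hpos
  · exact hstep i _ hpos
  · simpa only [Finset.sum_const_zero] using hC

theorem tsum_mul_prod_le (hμ : DeviceAssumptions μ p ωpk ωavg εω corr energy)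
    (hp : ∀ x, 0 < p x) (hf : ∀ i h l q, 0 ≤ f i h l q) (hC : 0 ≤ C)
    (hstep : ∀ i h l, 0 < prob μ (pastEvent i h l) →
      ∑ q, jointProb p (corr i h l) q * f i h l q ≤ C) :
    ∑' w, μ w * ENNReal.ofReal (∏ i, f i (past i w) w.2.2 (w.1 i, w.2.1 i))
      ≤ ENNReal.ofReal (C ^ n) := by
  have hprod (l : L) (s : Fin n → Output × Input) : 0 ≤ ∏ i,
      stepWeight μ p corr f i (past i (outcomeEquiv n L (l, s))) l (s i) :=
    Finset.prod_nonneg fun i _ ↦ hμ.stepWeight_nonneg hp hf _ _ _ _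
  have hpoint (w : Outcome n L) :
      μ w * ENNReal.ofReal (∏ i, f i (past i w) w.2.2 (w.1 i, w.2.1 i))
        ≤ μ.toOuterMeasure {w' | w'.2.2 = w.2.2} * ENNReal.ofReal (∏ i,
          stepWeight μ p corr f i (past i w) w.2.2 (w.1 i, w.2.1 i)) := by
    rw [← ofReal_prob, ← ENNReal.ofReal_mul (prob_nonneg μ _),
      ← ENNReal.ofReal_toReal (μ.apply_ne_top w), ← ENNReal.ofReal_mul ENNReal.toReal_nonneg]
    exact ENNReal.ofReal_le_ofReal (hμ.toReal_mul_prod_le hp hf w)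
  calc ∑' w, μ w * ENNReal.ofReal (∏ i, f i (past i w) w.2.2 (w.1 i, w.2.1 i))
      ≤ ∑' l, μ.toOuterMeasure {w | w.2.2 = l} * ENNReal.ofReal (C ^ n) := by
        rw [tsum_outcome]
        refine ENNReal.tsum_le_tsum fun l ↦ (Finset.sum_le_sum fun s _ ↦ hpoint _).trans ?_
        change ∑ s, μ.toOuterMeasure {w | w.2.2 = l} * ENNReal.ofReal (∏ i,
          stepWeight μ p corr f i (past i (outcomeEquiv n L (l, s))) l (s i)) ≤ _
        rw [← Finset.mul_sum, ← ENNReal.ofReal_sum_of_nonneg fun s _ ↦ hprod l s]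
        gcongr
        exact hμ.sum_prod_stepWeight_le hp hf hC l fun i h ↦ hstep i h l
    _ = ENNReal.ofReal (C ^ n) := by
        rw [ENNReal.tsum_mul_right, tsum_toOuterMeasure_fiber μ fun w ↦ w.2.2, one_mul]

end DeviceAssumptions

end ChainRule

section TestedDevice

variable {n : ℕ} {L : Type*} {P : ProtocolArgs} {μ : PMF (Outcome n L)}
  {corr energy : (i : Fin n) → History i → L → Input → ℝ}

/-- The increment `ξ(Aᵢ,Xᵢ) + γ · ωᵢ(Wᵢ,Λ) + log₂ μ(Aᵢ | Xᵢ, Wᵢ, Λ)` of round `i` of the run `w`. -/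
def roundIncrement (P : ProtocolArgs) (corr energy : (i : Fin n) → History i → L → Input → ℝ)
    (w : Outcome n L) (i : Fin n) : ℝ :=
  P.increment (corr i (past i w) w.2.2) (∑ x, P.γ x * energy i (past i w) w.2.2 x)
    (w.1 i, w.2.1 i)

theorem sum_roundIncrement (P : ProtocolArgs)
    (corr energy : (i : Fin n) → History i → L → Input → ℝ) (w : Outcome n L) :
    ∑ i, roundIncrement P corr energy w i = ∑ i, P.xi (w.1 i) (w.2.1 i)
      + ∑ i, ∑ x, P.γ x * energy i (past i w) w.2.2 x
      + ∑ i, Real.logb 2 (roundProb corr w i) := by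
  rw [← Finset.sum_add_distrib, ← Finset.sum_add_distrib]
  rfl

theorem tsum_mul_exp_sum_roundIncrement_le (hP : P.Valid n)
    (hμ : DeviceAssumptions μ P.p P.ωpk P.ωavg P.εω corr energy)
    {lam : ℝ} (hlam : 0 ≤ lam) (hlam_lt : lam * P.xiMax < 3) :
    ∑' w, μ w * ENNReal.ofReal (Real.exp (lam * ∑ i, roundIncrement P corr energy w i))
      ≤ ENNReal.ofReal (Real.exp (lam ^ 2 * P.V / (2 * (1 - lam * P.xiMax / 3))) ^ n) := by
  have henergy (i : Fin n) (h : History i) (l : L) (x : Input) : energy i h l x ≤ 1 :=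
    (hμ.maxPeak i h l x).trans (hP.ωpk_le_one x)
  have hγω (i : Fin n) (h : History i) (l : L) : ∑ x, P.γ x * energy i h l x ≤ 0 :=
    Finset.sum_nonpos fun x _ ↦ mul_nonpos_of_nonpos_of_nonneg (hP.tradeOff.1 x)
      (energy_nonneg_of_mem_quantumSet (hμ.quantum i h l) x)
  simp only [Finset.mul_sum, Real.exp_sum]
  exact hμ.tsum_mul_prod_le (f := fun i h l q ↦ Real.exp (lam * P.increment (corr i h l)
      (∑ x, P.γ x * energy i h l x) q)) hP.p_pos (fun _ _ _ _ ↦ (Real.exp_pos _).le)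
    (Real.exp_pos _).le fun i h l hpos ↦
      P.sum_jointProb_mul_exp_increment_le hP.p_pos hP.p_sum hP.xiMax_nonneg
        (P.gammaBar_le_sum_mul hP.tradeOff.1 (henergy i h l)) (hγω i h l)
        (hμ.outProb_nonneg hP.p_pos hpos)
        (hP.tradeOff.2 _ _ (hμ.quantum i h l) (hμ.maxPeak i h l)) hlam hlam_lt

theorem prob_lt_sum_roundIncrement_le (hP : P.Valid n)
    (hμ : DeviceAssumptions μ P.p P.ωpk P.ωavg P.εω corr energy) :
    prob μ {w | n * P.t n < ∑ i, roundIncrement P corr energy w i} ≤ P.εt := by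
  have hn : (0 : ℝ) < n := by exact_mod_cast hP.rounds_pos
  have hlog : 0 ≤ Real.logb 2 (1 / P.εt) :=
    Real.logb_nonneg one_lt_two ((one_le_div hP.εt_pos).2 hP.εt_le_one)
  rw [P.mul_t_eq hP.rounds_pos]
  refine (prob_lt_le_exp_neg_of_subgamma (mul_pos hn P.V_pos)
    (div_nonneg hP.xiMax_nonneg zero_le_three) hlog fun lam hlam hlam_lt ↦ ?_).trans
    (exp_neg_logb_two_le hP.εt_pos hP.εt_le_one)
  refine (tsum_mul_exp_sum_roundIncrement_le hP hμ hlam (by linarith)).trans_eq ?_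
  rw [← Real.exp_nat_mul, ← mul_div_assoc lam, ← mul_div_assoc, mul_left_comm]

/-- The runs that obey the average energy constraint and have a typical total increment. -/
def typicalEvent (P : ProtocolArgs) (corr energy : (i : Fin n) → History i → L → Input → ℝ) :
    Set (Outcome n L) :=
  {w | (∀ x, (1 / (n : ℝ)) * ∑ i, energy i (past i w) w.2.2 x ≤ P.ωavg x) ∧
    ∑ i, roundIncrement P corr energy w i ≤ n * P.t n}

theorem prob_compl_typicalEvent_le (hP : P.Valid n)
    (hμ : DeviceAssumptions μ P.p P.ωpk P.ωavg P.εω corr energy) :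
    prob μ (typicalEvent P corr energy)ᶜ ≤ P.εω + P.εt := by
  have hsub : (typicalEvent P corr energy)ᶜ ⊆
      {w | ∀ x, (1 / (n : ℝ)) * ∑ i, energy i (past i w) w.2.2 x ≤ P.ωavg x}ᶜ ∪
        {w | n * P.t n < ∑ i, roundIncrement P corr energy w i} := by
    intro w hw
    rcases not_and_or.1 hw with henergy | hincr
    · exact Or.inl henergy
    · exact Or.inr (not_le.1 hincr)
  refine ((prob_mono μ hsub).trans (prob_union_le μ _ _)).trans (add_le_add ?_
    (prob_lt_sum_roundIncrement_le hP hμ))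
  rw [prob_compl]
  linarith [hμ.maxAverage]

theorem sum_logb_roundProb_le (hn : 1 ≤ n) (hγ : ∀ x, P.γ x ≤ 0) {w : Outcome n L}
    (hw : w ∈ typicalEvent P corr energy) (hpass : w ∈ P.passEvent n L) :
    ∑ i, Real.logb 2 (roundProb corr w i) ≤ -(n * (P.r - P.t n)) := by
  have hn0 : (0 : ℝ) < n := by exact_mod_cast hn
  have htest : P.r ≤ (1 / (n : ℝ)) * ∑ i, P.xi (w.1 i) (w.2.1 i) + ∑ x, P.γ x * P.ωavg x := hpass
  have henergy : ∑ x, P.γ x * P.ωavg x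
      ≤ (1 / (n : ℝ)) * ∑ i, ∑ x, P.γ x * energy i (past i w) w.2.2 x := by
    rw [Finset.sum_comm, Finset.mul_sum]
    refine Finset.sum_le_sum fun x _ ↦ ?_
    rw [← Finset.mul_sum, mul_left_comm]
    exact mul_le_mul_of_nonpos_left (hw.1 x) (hγ x)
  have hscore : n * P.r ≤ ∑ i, P.xi (w.1 i) (w.2.1 i)
      + ∑ i, ∑ x, P.γ x * energy i (past i w) w.2.2 x := by
    have hmul := mul_le_mul_of_nonneg_left (htest.trans (add_le_add_right henergy _)) hn0.le
    rwa [← mul_add, ← mul_assoc, mul_one_div_cancel hn0.ne', one_mul] at hmul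
  have hincr := hw.2
  rw [sum_roundIncrement] at hincr
  linarith

theorem apply_le_of_mem_typicalEvent (hP : P.Valid n)
    (hμ : DeviceAssumptions μ P.p P.ωpk P.ωavg P.εω corr energy) {w : Outcome n L}
    (hw : w ∈ typicalEvent P corr energy) (hpass : w ∈ P.passEvent n L) :
    μ w ≤ marginalZ μ w.2 * ENNReal.ofReal ((2 : ℝ) ^ (-(n * (P.r - P.t n)))) := by
  rcases (ENNReal.toReal_nonneg (a := μ w)).eq_or_lt with h0 | hpos
  · rw [((ENNReal.toReal_eq_zero_iff _).1 h0.symm).resolve_right (μ.apply_ne_top w)]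
    exact zero_le
  have hchain := hμ.toReal_apply_eq_marginalZ_mul w
  have hprod : 0 < ∏ i, roundProb corr w i :=
    pos_of_mul_pos_right (hchain ▸ hpos) ENNReal.toReal_nonneg
  have hlog : Real.logb 2 (∏ i, roundProb corr w i) ≤ -(n * (P.r - P.t n)) := by
    rw [Real.logb_prod _ _ fun i hi ↦ Finset.prod_ne_zero_iff.1 hprod.ne' i hi]
    exact sum_logb_roundProb_le hP.rounds_pos hP.tradeOff.1 hw hpass
  rw [Real.logb_le_iff_le_rpow one_lt_two hprod] at hlog
  rw [← ENNReal.ofReal_toReal (μ.apply_ne_top w),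
    ← ENNReal.ofReal_toReal ((marginalZ μ).apply_ne_top w.2),
    ← ENNReal.ofReal_mul ENNReal.toReal_nonneg, hchain]
  exact ENNReal.ofReal_le_ofReal (mul_le_mul_of_nonneg_left hlog ENNReal.toReal_nonneg)

end TestedDevice

section Smoothing

theorem exists_redistribution {A : Type*} [Fintype A] {f : A → ℝ} (G : Set A) {c : ℝ}
    (hf : ∀ a, 0 ≤ f a) (hc : 0 ≤ c) (hG : ∀ a ∈ G, f a ≤ c)
    (hsum : ∑ a, f a ≤ Fintype.card A * c) :
    ∃ g : A → ℝ, (∀ a, 0 ≤ g a) ∧ (∀ a, g a ≤ c) ∧ (∀ a ∈ G, f a ≤ g a) ∧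
      ∑ a, g a = ∑ a, f a := by
  set τ : A → ℝ := G.indicator f
  have hτ_nonneg (a : A) : 0 ≤ τ a := Set.indicator_nonneg (fun a _ ↦ hf a) a
  have hτ_le (a : A) : τ a ≤ c := Set.indicator_apply_le' (hG a) fun _ ↦ hc
  have hτ_sum : ∑ a, τ a ≤ ∑ a, f a :=
    Finset.sum_le_sum fun a _ ↦ Set.indicator_le_self' (fun a _ ↦ hf a) a
  set missing := ∑ a, f a - ∑ a, τ a
  set room := Fintype.card A * c - ∑ a, τ a
  have hmissing : 0 ≤ missing := sub_nonneg.2 hτ_sum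
  have hle : missing ≤ room := sub_le_sub_right hsum _
  set θ := missing / room
  have hθ0 : 0 ≤ θ := div_nonneg hmissing (hmissing.trans hle)
  have hθ1 : θ ≤ 1 := div_le_one_of_le₀ hle (hmissing.trans hle)
  have hfill : room * θ = missing :=
    mul_div_cancel_of_imp' fun h ↦ le_antisymm (h ▸ hle) hmissing
  have hadd (a : A) : 0 ≤ (c - τ a) * θ := mul_nonneg (sub_nonneg.2 (hτ_le a)) hθ0
  refine ⟨fun a ↦ τ a + (c - τ a) * θ, fun a ↦ add_nonneg (hτ_nonneg a) (hadd a), fun a ↦ ?_,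
    fun a ha ↦ ?_, ?_⟩
  · linarith [mul_le_of_le_one_right (sub_nonneg.2 (hτ_le a)) hθ1]
  · rw [show f a = τ a from (Set.indicator_of_mem ha f).symm]
    exact le_add_of_nonneg_right (hadd a)
  · rw [Finset.sum_add_distrib, ← Finset.sum_mul, Finset.sum_sub_distrib, Finset.sum_const,
      Finset.card_univ, nsmul_eq_mul]
    change ∑ a, τ a + room * θ = _
    rw [hfill, add_sub_cancel]

theorem tvDist_le_prob_compl {Ω : Type*} {μ ν : PMF Ω} {G : Set Ω}
    (h : ∀ w ∈ G, (μ w).toReal ≤ (ν w).toReal) : tvDist ν μ ≤ prob μ Gᶜ := by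
  have hdiff := (hasSum_toReal ν).sub (hasSum_toReal μ)
  have hbound : HasSum (fun w ↦ (ν w).toReal - (μ w).toReal
      + 2 * Gᶜ.indicator (fun w ↦ (μ w).toReal) w) (1 - 1 + 2 * prob μ Gᶜ) :=
    hdiff.add ((hasSum_indicator_toReal μ Gᶜ).mul_left 2)
  have hpoint (w : Ω) : |(ν w).toReal - (μ w).toReal|
      ≤ (ν w).toReal - (μ w).toReal + 2 * Gᶜ.indicator (fun w ↦ (μ w).toReal) w := by
    by_cases hw : w ∈ G
    · rw [Set.indicator_of_notMem (Set.notMem_compl_iff.2 hw), mul_zero, add_zero,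
        abs_of_nonneg (sub_nonneg.2 (h w hw))]
    · rw [Set.indicator_of_mem (Set.mem_compl hw), abs_le]
      have hμ : 0 ≤ (μ w).toReal := ENNReal.toReal_nonneg
      have hν : 0 ≤ (ν w).toReal := ENNReal.toReal_nonneg
      constructor <;> linarith
  have hle := hasSum_le hpoint hdiff.summable.abs.hasSum hbound
  rw [tvDist]
  linarith

variable {A Z : Type*} [Fintype A]

theorem exists_pmf_of_sum_eq_marginalZ (μ : PMF (A × Z)) {g : Z → A → ℝ≥0∞}
    (hg : ∀ z, ∑ a, g z a = marginalZ μ z) :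
    ∃ ν : PMF (A × Z), marginalZ ν = marginalZ μ ∧ ∀ a z, ν (a, z) = g z a := by
  have htotal : ∑' w : A × Z, g w.2 w.1 = 1 := by
    rw [ENNReal.tsum_prod', ENNReal.tsum_comm, ← (marginalZ μ).tsum_coe]
    simp only [tsum_fintype, hg]
  let ν : PMF (A × Z) := ⟨fun w ↦ g w.2 w.1, htotal ▸ ENNReal.summable.hasSum⟩
  have hν (a : A) (z : Z) : ν (a, z) = g z a := rfl
  refine ⟨ν, ?_, hν⟩
  ext z
  simp only [marginalZ_apply ν, hν, hg]

theorem exists_smoothing (μ : PMF (A × Z)) (G : Set (A × Z)) {c : Z → ℝ≥0∞}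
    (hc : ∀ z, c z ≠ ⊤) (hG : ∀ w ∈ G, μ w ≤ c w.2)
    (hsum : ∀ z, marginalZ μ z ≤ Fintype.card A * c z) :
    ∃ ν : PMF (A × Z), marginalZ ν = marginalZ μ ∧ tvDist ν μ ≤ prob μ Gᶜ ∧
      ∀ a z, ν (a, z) ≤ c z := by
  have hmarginal (z : Z) : (marginalZ μ z).toReal = ∑ a, (μ (a, z)).toReal := by
    rw [marginalZ_apply, ENNReal.toReal_sum fun a _ ↦ μ.apply_ne_top _]
  have hfiber (z : Z) : ∃ g : A → ℝ, (∀ a, 0 ≤ g a) ∧ (∀ a, g a ≤ (c z).toReal) ∧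
      (∀ a ∈ {a | (a, z) ∈ G}, (μ (a, z)).toReal ≤ g a) ∧ ∑ a, g a = ∑ a, (μ (a, z)).toReal := by
    refine exists_redistribution _ (fun _ ↦ ENNReal.toReal_nonneg) ENNReal.toReal_nonneg
      (fun a ha ↦ ENNReal.toReal_mono (hc z) (hG (a, z) ha)) ?_
    have hle := ENNReal.toReal_mono (ENNReal.mul_ne_top (ENNReal.natCast_ne_top _) (hc z)) (hsum z)
    rwa [hmarginal, ENNReal.toReal_mul, ENNReal.toReal_natCast] at hle
  choose g hg_nonneg hg_le hg_ge hg_sum using hfiber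
  obtain ⟨ν, hνZ, hν⟩ := exists_pmf_of_sum_eq_marginalZ μ (g := fun z a ↦ ENNReal.ofReal (g z a))
    fun z ↦ by
      rw [← ENNReal.ofReal_sum_of_nonneg fun a _ ↦ hg_nonneg z a, hg_sum, ← hmarginal,
        ENNReal.ofReal_toReal ((marginalZ μ).apply_ne_top z)]
  refine ⟨ν, hνZ, tvDist_le_prob_compl ?_, fun a z ↦ ?_⟩
  · rintro ⟨a, z⟩ haz
    rw [hν, ENNReal.toReal_ofReal (hg_nonneg z a)]
    exact hg_ge z a haz
  · rw [hν]
    exact ENNReal.ofReal_le_of_le_toReal (hg_le z a)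

end Smoothing

section Conditioning

variable {Ω : Type*} {μ : PMF Ω} {S : Set Ω}

theorem condOn_apply_of_mem (h : 0 < prob μ S) {w : Ω} (hw : w ∈ S) :
    condOn μ S h w = μ w / μ.toOuterMeasure S := by
  rw [condOn, PMF.filter_apply, Set.indicator_of_mem hw, PMF.toOuterMeasure_apply, div_eq_mul_inv]

theorem condOn_apply_of_notMem (h : 0 < prob μ S) {w : Ω} (hw : w ∉ S) : condOn μ S h w = 0 :=
  PMF.filter_apply_eq_zero_of_notMem _ hw

theorem condOn_apply_le (h : 0 < prob μ S) (w : Ω) :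
    condOn μ S h w ≤ μ w / μ.toOuterMeasure S := by
  by_cases hw : w ∈ S
  · exact (condOn_apply_of_mem h hw).le
  · exact (condOn_apply_of_notMem h hw).trans_le zero_le

theorem toOuterMeasure_condOn_le (h : 0 < prob μ S) (T : Set Ω) :
    (condOn μ S h).toOuterMeasure T ≤ μ.toOuterMeasure T / μ.toOuterMeasure S := by
  rw [PMF.toOuterMeasure_apply, PMF.toOuterMeasure_apply μ T, div_eq_mul_inv,
    ← ENNReal.tsum_mul_right]
  refine ENNReal.tsum_le_tsum fun w ↦ Set.indicator_apply_le' (fun hw ↦ ?_) fun _ ↦ zero_le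
  rw [Set.indicator_of_mem hw, ← div_eq_mul_inv]
  exact condOn_apply_le h w

theorem prob_condOn_le (h : 0 < prob μ S) (T : Set Ω) :
    prob (condOn μ S h) T ≤ prob μ T / prob μ S := by
  rw [prob, prob, prob, ← ENNReal.toReal_div]
  exact ENNReal.toReal_mono
    (ENNReal.div_ne_top (toOuterMeasure_ne_top μ T) (toOuterMeasure_ne_zero h))
    (toOuterMeasure_condOn_le h T)

theorem marginalZ_toOuterMeasure {A Z : Type*} (ρ : PMF (A × Z)) (T : Set Z) :
    (marginalZ ρ).toOuterMeasure T = ρ.toOuterMeasure {w | w.2 ∈ T} :=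
  PMF.toOuterMeasure_map_apply _ ρ T

theorem marginalZ_condOn_le {A Z : Type*} {μ : PMF (A × Z)} {S : Set (A × Z)}
    (h : 0 < prob μ S) (z : Z) :
    marginalZ (condOn μ S h) z ≤ marginalZ μ z / μ.toOuterMeasure S := by
  simp only [← PMF.toOuterMeasure_apply_singleton (marginalZ _), marginalZ_toOuterMeasure]
  exact toOuterMeasure_condOn_le h _

theorem prob_marginalZ_lt_le {A Z : Type*} (ρ : PMF (A × Z)) (q : PMF Z) {C : ℝ} (hC : 0 ≤ C) :
    prob ρ {w | marginalZ ρ w.2 < q w.2 * ENNReal.ofReal C} ≤ C := by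
  refine ENNReal.toReal_le_of_le_ofReal hC ?_
  calc ρ.toOuterMeasure {w | marginalZ ρ w.2 < q w.2 * ENNReal.ofReal C}
      = (marginalZ ρ).toOuterMeasure {z | marginalZ ρ z < q z * ENNReal.ofReal C} :=
        (marginalZ_toOuterMeasure ρ {z | marginalZ ρ z < q z * ENNReal.ofReal C}).symm
    _ ≤ ∑' z, q z * ENNReal.ofReal C := by
        rw [PMF.toOuterMeasure_apply]
        exact ENNReal.tsum_le_tsum fun z ↦
          Set.indicator_apply_le' (fun hz ↦ le_of_lt hz) fun _ ↦ zero_le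
    _ = ENNReal.ofReal C := by rw [ENNReal.tsum_mul_right, q.tsum_coe, one_mul]

end Conditioning

section MinEntropy

variable {A Z : Type*}

theorem condProb_le {ν : PMF (A × Z)} {a : A} {z : Z} {C : ℝ≥0∞}
    (h : ν (a, z) ≤ C * marginalZ ν z) : condProb ν a z ≤ C :=
  ENNReal.div_le_of_le_mul h

theorem marginalZ_mul_iSup_condProb_le {ν : PMF (A × Z)} {z : Z} {C : ℝ≥0∞}
    (h : ∀ a, ν (a, z) ≤ C) : marginalZ ν z * (⨆ a, condProb ν a z) ≤ C := by
  rw [ENNReal.mul_iSup]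
  exact iSup_le fun a ↦ ENNReal.mul_div_le.trans (h a)

theorem one_le_mul_ofReal_two_rpow_neg {N : ℕ} {s : ℝ} (h : (2 : ℝ) ^ s ≤ N) :
    1 ≤ (N : ℝ≥0∞) * ENNReal.ofReal ((2 : ℝ) ^ (-s)) := by
  rw [← ENNReal.ofReal_natCast, ← ENNReal.ofReal_mul (Nat.cast_nonneg _), ENNReal.one_le_ofReal,
    Real.rpow_neg zero_le_two, ← div_eq_mul_inv]
  exact (one_le_div (Real.rpow_pos_of_pos two_pos s)).2 h

theorem ofReal_two_rpow_neg_sub_logb (s : ℝ) {c : ℝ} (hc : 0 < c) :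
    ENNReal.ofReal ((2 : ℝ) ^ (-(s - Real.logb 2 (1 / c))))
      = ENNReal.ofReal ((2 : ℝ) ^ (-s)) / ENNReal.ofReal c := by
  rw [neg_sub, sub_eq_neg_add, Real.rpow_add two_pos,
    Real.rpow_logb two_pos (by norm_num) (one_div_pos.2 hc), mul_one_div,
    ENNReal.ofReal_div_of_pos hc]

theorem condOn_apply_le_of_mem {μ : PMF (A × Z)} {S G : Set (A × Z)} {K : ℝ≥0∞}
    (hpos : 0 < prob μ S) (hle : ∀ w ∈ G ∩ S, μ w ≤ marginalZ μ w.2 * K) {w : A × Z} (hw : w ∈ G) :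
    condOn μ S hpos w ≤ marginalZ μ w.2 * K / μ.toOuterMeasure S := by
  by_cases hS : w ∈ S
  · rw [condOn_apply_of_mem hpos hS]
    exact ENNReal.div_le_div_right (hle w ⟨hw, hS⟩) _
  · exact (condOn_apply_of_notMem hpos hS).trans_le zero_le

variable {μ : PMF (A × Z)} {S G : Set (A × Z)} {ε δ s : ℝ}

/-- The outcomes for which conditioning on `S` keeps at least the fraction `δ / prob μ S` of the
probability of the value of `Z`. They are the ones on which a bound relative to `marginalZ μ` can
be turned into one relative to the marginal of the conditioned distribution. -/
def heavyEvent (μ : PMF (A × Z)) (S : Set (A × Z)) (hpos : 0 < prob μ S) (δ : ℝ) : Set (A × Z) :=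
  {w | marginalZ μ w.2 * ENNReal.ofReal (δ / prob μ S) ≤ marginalZ (condOn μ S hpos) w.2}

theorem prob_condOn_compl_heavyEvent_le (hpos : 0 < prob μ S) (hδ : 0 ≤ δ) :
    prob (condOn μ S hpos) (heavyEvent μ S hpos δ)ᶜ ≤ δ / prob μ S := by
  have hcompl : (heavyEvent μ S hpos δ)ᶜ = {w | marginalZ (condOn μ S hpos) w.2
      < marginalZ μ w.2 * ENNReal.ofReal (δ / prob μ S)} := by
    ext w
    exact not_le (α := ℝ≥0∞)
  rw [hcompl]
  exact prob_marginalZ_lt_le _ _ (div_nonneg hδ hpos.le)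

theorem condOn_apply_le_of_mem_heavyEvent {K : ℝ≥0∞} (hpos : 0 < prob μ S) (hδ : 0 < δ)
    (hle : ∀ w ∈ G ∩ S, μ w ≤ marginalZ μ w.2 * K) {w : A × Z}
    (hw : w ∈ G ∩ heavyEvent μ S hpos δ) :
    condOn μ S hpos w ≤ K / ENNReal.ofReal δ * marginalZ (condOn μ S hpos) w.2 := by
  calc condOn μ S hpos w ≤ marginalZ μ w.2 * K / μ.toOuterMeasure S :=
        condOn_apply_le_of_mem hpos hle hw.1
    _ = K / ENNReal.ofReal δ * (marginalZ μ w.2 * ENNReal.ofReal (δ / prob μ S)) := by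
        rw [ENNReal.ofReal_div_of_pos hpos, ofReal_prob, mul_left_comm, ← mul_div_assoc,
          ENNReal.div_mul_cancel (ENNReal.ofReal_pos.2 hδ).ne' ENNReal.ofReal_ne_top, mul_div_assoc]
    _ ≤ K / ENNReal.ofReal δ * marginalZ (condOn μ S hpos) w.2 := mul_le_mul_right hw.2 _

variable [Fintype A]

theorem sub_logb_mem_avgAchievable_condOn (hpos : 0 < prob μ S) (hG : prob μ Gᶜ ≤ ε)
    (hle : ∀ w ∈ G ∩ S, μ w ≤ marginalZ μ w.2 * ENNReal.ofReal ((2 : ℝ) ^ (-s)))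
    (hcard : (2 : ℝ) ^ s ≤ Fintype.card A) :
    s - Real.logb 2 (1 / prob μ S) ∈ avgAchievable (ε / prob μ S) (condOn μ S hpos) := by
  set K := ENNReal.ofReal ((2 : ℝ) ^ (-s))
  have hroom (z : Z) : marginalZ (condOn μ S hpos) z
      ≤ Fintype.card A * (marginalZ μ z * K / μ.toOuterMeasure S) := by
    refine (marginalZ_condOn_le hpos z).trans ?_
    rw [← mul_div_assoc, mul_left_comm]
    exact ENNReal.div_le_div_right
      (le_mul_of_one_le_right zero_le (one_le_mul_ofReal_two_rpow_neg hcard)) _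
  obtain ⟨ν, hνZ, hνtv, hν⟩ := exists_smoothing (condOn μ S hpos) G
    (fun z ↦ ENNReal.div_ne_top (ENNReal.mul_ne_top ((marginalZ μ).apply_ne_top z)
      ENNReal.ofReal_ne_top) (toOuterMeasure_ne_zero hpos))
    (fun _ ↦ condOn_apply_le_of_mem hpos hle) hroom
  refine ⟨ν, hνZ, hνtv.trans ((prob_condOn_le hpos _).trans (by gcongr)), ?_⟩
  calc ∑' z, marginalZ ν z * (⨆ a, condProb ν a z)
      ≤ ∑' z, marginalZ μ z * (K / μ.toOuterMeasure S) :=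
        ENNReal.tsum_le_tsum fun z ↦
          marginalZ_mul_iSup_condProb_le fun a ↦ (hν a z).trans_eq (mul_div_assoc _ _ _)
    _ = K / μ.toOuterMeasure S := by rw [ENNReal.tsum_mul_right, PMF.tsum_coe, one_mul]
    _ = _ := by rw [ofReal_two_rpow_neg_sub_logb s hpos, ofReal_prob]

theorem sub_logb_mem_worstAchievable_condOn (hpos : 0 < prob μ S) (hG : prob μ Gᶜ ≤ ε)
    (hle : ∀ w ∈ G ∩ S, μ w ≤ marginalZ μ w.2 * ENNReal.ofReal ((2 : ℝ) ^ (-s)))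
    (hcard : (2 : ℝ) ^ s ≤ Fintype.card A) (hδ0 : 0 < δ) (hδ1 : δ ≤ 1) :
    s - Real.logb 2 (1 / δ) ∈ worstAchievable ((ε + δ) / prob μ S) (condOn μ S hpos) := by
  set K := ENNReal.ofReal ((2 : ℝ) ^ (-s))
  set ρ := condOn μ S hpos
  have hδ : ENNReal.ofReal δ ≠ 0 := (ENNReal.ofReal_pos.2 hδ0).ne'
  have hroom (z : Z) : marginalZ ρ z
      ≤ Fintype.card A * (K / ENNReal.ofReal δ * marginalZ ρ z) := by
    rw [← mul_assoc, ← mul_div_assoc]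
    refine le_mul_of_one_le_left zero_le ?_
    rw [ENNReal.le_div_iff_mul_le (Or.inl hδ) (Or.inl ENNReal.ofReal_ne_top), one_mul]
    exact (ENNReal.ofReal_le_one.2 hδ1).trans (one_le_mul_ofReal_two_rpow_neg hcard)
  obtain ⟨ν, hνZ, hνtv, hν⟩ := exists_smoothing ρ (G ∩ heavyEvent μ S hpos δ)
    (fun z ↦ ENNReal.mul_ne_top (ENNReal.div_ne_top ENNReal.ofReal_ne_top hδ)
      ((marginalZ ρ).apply_ne_top z))
    (fun _ ↦ condOn_apply_le_of_mem_heavyEvent hpos hδ0 hle) hroom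
  refine ⟨ν, hνZ, hνtv.trans ?_, fun a z ↦ ?_⟩
  · rw [Set.compl_inter, add_div]
    refine (prob_union_le ρ _ _).trans (add_le_add ((prob_condOn_le hpos _).trans ?_)
      (prob_condOn_compl_heavyEvent_le hpos hδ0.le))
    gcongr
  · rw [ofReal_two_rpow_neg_sub_logb s hδ0]
    refine condProb_le ?_
    rw [hνZ]
    exact hν a z

end MinEntropy

theorem two_rpow_mul_le_card_output {n : ℕ} {s : ℝ} (hs : s ≤ 1) :
    (2 : ℝ) ^ (n * s) ≤ Fintype.card (Fin n → Output) := by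
  rw [Fintype.card_fun, Fintype.card_units_int, Fintype.card_fin, Nat.cast_pow, Nat.cast_ofNat,
    ← Real.rpow_natCast]
  exact Real.rpow_le_rpow_of_exponent_le one_le_two
    (mul_le_of_le_one_right (Nat.cast_nonneg n) hs)

end SemiDI

end

theorem proposition6 {n : ℕ} {L : Type*} (P : SemiDI.ProtocolArgs) (hP : P.Valid n)
    (μ : PMF (SemiDI.Outcome n L))
    (corr energy : (i : Fin n) → SemiDI.History i → L → SemiDI.Input → ℝ)
    (hμ : SemiDI.DeviceAssumptions μ P.p P.ωpk P.ωavg P.εω corr energy)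
    (κ : ℝ) (hκ : κ = SemiDI.prob μ (P.passEvent n L))
    (hpos : 0 < SemiDI.prob μ (P.passEvent n L)) :
    -- smooth average conditional min-entropy
    (n * (P.r - P.t n) - Real.logb 2 (1 / κ) ∈
        SemiDI.avgAchievable ((P.εω + P.εt) / κ) (SemiDI.condOn μ (P.passEvent n L) hpos) ∧
      ((n * (P.r - P.t n) - Real.logb 2 (1 / κ) : ℝ) : EReal) ≤
        SemiDI.smoothAvgMinEntropy ((P.εω + P.εt) / κ)
          (SemiDI.condOn μ (P.passEvent n L) hpos)) ∧
    -- smooth worst-case conditional min-entropy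
    (n * (P.r - P.t n) - Real.logb 2 (1 / P.εm) ∈
        SemiDI.worstAchievable ((P.εω + P.εt + P.εm) / κ)
          (SemiDI.condOn μ (P.passEvent n L) hpos) ∧
      ((n * (P.r - P.t n) - Real.logb 2 (1 / P.εm) : ℝ) : EReal) ≤
        SemiDI.smoothWorstMinEntropy ((P.εω + P.εt + P.εm) / κ)
          (SemiDI.condOn μ (P.passEvent n L) hpos)) ∧
    n * (P.r - P.t n) - Real.logb 2 (1 / P.εm) = P.sigmaH n := by
  subst hκ
  have htypical := SemiDI.prob_compl_typicalEvent_le hP hμ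
  have hbound (w) (hw : w ∈ SemiDI.typicalEvent P corr energy ∩ P.passEvent n L) :=
    SemiDI.apply_le_of_mem_typicalEvent hP hμ hw.1 hw.2
  have hcard := SemiDI.two_rpow_mul_le_card_output (n := n) hP.r_sub_t_le_one
  have havg := SemiDI.sub_logb_mem_avgAchievable_condOn hpos htypical hbound hcard
  have hworst := SemiDI.sub_logb_mem_worstAchievable_condOn hpos htypical hbound hcard
    hP.εm_pos hP.εm_le_one
  exact ⟨⟨havg, le_sSup ⟨_, havg, rfl⟩⟩, ⟨hworst, le_sSup ⟨_, hworst, rfl⟩⟩,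
    P.sigmaH_eq hP.rounds_pos⟩
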